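/- A \emph{protocol} is a tuple $P=(Q,\Sigma,q_{in},T)$ with $Q$ a finite set of states, $\Sigma$ a finite alphabet of messages, $q_{in}\in Q$ an initial state, and $T\subseteq Q\times(\{!!m,\,!m,\,?m : m\in\Sigma\}\cup\{\tau\})\times Q$. It is \emph{Wait-Only} if no state has both an outgoing transition labelled by a reception $?m$ and an outgoing transition labelled by an action ($!!m$, $!m$ or $\tau$). Let $R(q)=\{m : \exists q',\ (q,?m,q')\in T\}$. A \emph{configuration} is a non-empty finite multiset over $Q$; it is \emph{initial} if all its elements equal $q_{in}$. One writes $C\to C'$ if for some $(q,\alpha,q')\in T$ one of the following holds, where $D,D'$ are multisets over $Q$ and $+$ is the sum of multisets: (a) $\alpha=\tau$, $C=\{q\}+D$ and $C'=\{q'\}+D$; (b) (broadcast) $\alpha={!!m}$, $C=\{q\}+D$ and $C'=\{q'\}+D'$, where $D'$ is obtained from $D$ by replacing each element $p$ with $m\in R(p)$ by some $p'$ with $(p,?m,p')\in T$, and keeping each element $p$ with $m\notin R(p)$; (c) (rendez-vous without receiver) $\alpha={!m}$, $C=\{q\}+D$, $C'=\{q'\}+D$, and $m\notin R(p)$ for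 every $p$ in $D$; (d) (rendez-vous) $\alpha={!m}$, $C=\{q\}+\{p\}+D$ and $C'=\{q'\}+\{p'\}+D$ for some $(p,?m,p')\in T$. Let $\to^*$ be the reflexive transitive closure of $\to$ on configurations. A state $q_f\in Q$ is \emph{coverable} if there are an initial configuration $C$ (with any number of processes) and a configuration $C'$ such that $C\to^* C'$ and $C'(q_f)>0$. \textbf{Theorem.} The state coverability problem StateCover for Wait-Only protocols (given a Wait-Only protocol $P$ and a state $q_f$ of $P$, is $q_f$ coverable?) is in the complexity class P. That is, name states and messages by bit strings and describe a protocol together with a state by a word over a fixed finite alphabet that lists explicitly the states, the messages, the initial state, the transitions and the state in question; then a deterministic Turing machine decides, for every word $w$ over that alphabet and in time polynomial in the length of $w$, whether $w$ describes a Wait-Only protocol together with a coverable state of it. -/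

import Mathlib

namespace BroadcastNet

/-- The labels over a set `β` of messages: an internal action, a broadcast `!!m`,
a (non-blocking) rendez-vous request `!m`, and a reception `?m`. -/
inductive Op (β : Type*) where
  | tau : Op β
  | bcast (m : β) : Op β
  | send (m : β) : Op β
  | recv (m : β) : Op β

/-- The message occurring in a label, if any. -/
def Op.msg {β : Type*} : Op β → Option β
  | .tau => none
  | .bcast m => some m
  | .send m => some m
  | .recv m => some m

/-- The labels `!!m`, `!m` and `tau`, as opposed to the receptions `?m`. -/
def Op.IsAct {β : Type*} : Op β → Prop
  | .tau => True
  | .bcast _ => True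
  | .send _ => True
  | .recv _ => False

/-- A protocol `(Q, Σ, q_in, T)`, whose states are elements of `α` and whose messages are
elements of `β`. -/
structure Protocol (α β : Type*) where
  /-- the finite set `Q` of states -/
  states : Finset α
  /-- the finite alphabet `Σ` of messages -/
  messages : Finset β
  /-- the initial state -/
  init : α
  /-- the transition relation -/
  trans : Finset (α × Op β × α)
  init_mem : init ∈ states
  trans_mem : ∀ q a q', (q, a, q') ∈ trans →
    q ∈ states ∧ q' ∈ states ∧ ∀ m, a.msg = some m → m ∈ messages

namespace Protocol

variable {α β : Type*} (P : Protocol α β)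

/-- No state has both an outgoing reception and an outgoing transition of another kind. -/
def WaitOnly : Prop :=
  ∀ q ∈ P.states,
    (¬ ∃ m q', (q, Op.recv m, q') ∈ P.trans) ∨
    (¬ ∃ a q', Op.IsAct a ∧ (q, a, q') ∈ P.trans)

/-- A configuration is a non-empty multiset of states. -/
def Config : Type _ := {C : Multiset α // C ≠ 0 ∧ ∀ q ∈ C, q ∈ P.states}

/-- A configuration is initial when all its processes are in the initial state. -/
def IsInitial (C : P.Config) : Prop := ∀ q ∈ C.1, q = P.init

/-- The message `m` can be received in the state `q`, i.e. `m ∈ R(q)`. -/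
def CanRecv (m : β) (q : α) : Prop := ∃ q', (q, Op.recv m, q') ∈ P.trans

/-- How a process in state `p` may react to a broadcast of `m`. -/
def Reacts (m : β) (p p' : α) : Prop :=
  (¬ P.CanRecv m p ∧ p' = p) ∨ (p, Op.recv m, p') ∈ P.trans

/-- `P.Fires (q, a, q') C C'`: the transition `(q, a, q')`, taken by one process of `C`, leads
from `C` to `C'`. The multiset `D` consists of the other processes (in the last case: of the
processes other than the sender and the receiver). -/
inductive Fires : α × Op β × α → Multiset α → Multiset α → Prop
  | tau (q q' : α) (D : Multiset α) :
      Fires (q, Op.tau, q') (q ::ₘ D) (q' ::ₘ D)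
  | bcast (m : β) (q q' : α) (D D' : Multiset α) (h : Multiset.Rel (P.Reacts m) D D') :
      Fires (q, Op.bcast m, q') (q ::ₘ D) (q' ::ₘ D')
  | sendAlone (m : β) (q q' : α) (D : Multiset α) (h : ∀ p ∈ D, ¬ P.CanRecv m p) :
      Fires (q, Op.send m, q') (q ::ₘ D) (q' ::ₘ D)
  | rendezvous (m : β) (q q' p p' : α) (D : Multiset α) (h : (p, Op.recv m, p') ∈ P.trans) :
      Fires (q, Op.send m, q') (q ::ₘ p ::ₘ D) (q' ::ₘ p' ::ₘ D)

/-- The one-step relation on configurations. -/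
def Step (C C' : P.Config) : Prop := ∃ t ∈ P.trans, P.Fires t C.1 C'.1

/-- The state `q` is coverable: some configuration with a process in `q` is reachable from
some initial configuration (with any number of processes). -/
def Coverable (q : α) : Prop :=
  ∃ C C' : P.Config, P.IsInitial C ∧ Relation.ReflTransGen P.Step C C' ∧ q ∈ C'.1

end Protocol

/-! ### Protocols as inputs of a machine -/

/-- The input alphabet. -/
inductive Sym where
  | bit (b : Bool)
  | comma
  | hash
  | tau
  | bcast
  | send
  | recv

/-- States and messages of an input protocol are named by bit strings. -/
abbrev Name : Type := List Bool

def encodeName (x : Name) : List Sym := x.map Sym.bit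

/-- Each item of a list of names is followed by a comma. -/
def encodeNames (l : List Name) : List Sym :=
  l.flatMap fun x => encodeName x ++ [Sym.comma]

def encodeOp : Op Name → List Sym
  | .tau => [Sym.tau]
  | .bcast m => Sym.bcast :: (encodeName m ++ [Sym.comma])
  | .send m => Sym.send :: (encodeName m ++ [Sym.comma])
  | .recv m => Sym.recv :: (encodeName m ++ [Sym.comma])

def encodeTrans (l : List (Name × Op Name × Name)) : List Sym :=
  l.flatMap fun t => encodeName t.1 ++ encodeOp t.2.1 ++ encodeName t.2.2 ++ [Sym.comma]

/-- The word `w` describes the protocol `P` together with the state `q`: it lists explicitly, in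
any order, the states, the messages and the transitions of `P`. -/
def Encodes (w : List Sym) (P : Protocol Name Name) (q : Name) : Prop :=
  ∃ (ls lm : List Name) (lt : List (Name × Op Name × Name)),
    (∀ x, x ∈ ls ↔ x ∈ P.states) ∧
    (∀ m, m ∈ lm ↔ m ∈ P.messages) ∧
    (∀ t, t ∈ lt ↔ t ∈ P.trans) ∧
    w = encodeNames ls ++ [Sym.hash] ++ encodeNames lm ++ [Sym.hash] ++ encodeName P.init ++
      [Sym.hash] ++ encodeTrans lt ++ [Sym.hash] ++ encodeName q

/-- The problem StateCover restricted to Wait-Only protocols, as a language: the words that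
describe a Wait-Only protocol together with one of its states that is coverable. -/
def stateCoverWaitOnly : Language Sym :=
  {w | ∃ (P : Protocol Name Name) (q : Name),
    q ∈ P.states ∧ Encodes w P q ∧ P.WaitOnly ∧ P.Coverable q}

open Classical in
/-- The complexity class P: some Turing machine (with finitely many stacks) decides, for every
word over the alphabet, whether the word is in `L`, within a number of steps that is polynomial
in the length of the word. -/
def InP {Γ : Type} (L : Language Γ) : Prop :=
  Nonempty (Turing.TM2ComputableInPolyTime (id : List Γ → List Γ) Computability.encodeBool
    fun w => decide (w ∈ L))

end BroadcastNet

namespace BroadcastNet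

/-! For Wait-Only protocols coverability is a plain saturation: begin with the initial state, follow
every action out of a reached state, and follow a reception `?m` out of a reached state as soon as
some reached state emits `m`. In any protocol the coverable states lie in this saturation
(`Coverable.derivable`). Conversely, in a Wait-Only protocol a state with an outgoing action
receives nothing, so a process waiting there cannot be moved by the others. As the number of
processes is unbounded, runs covering two states can be executed by two groups, one after the other,
without losing the process that is about to emit (`Runs.add_bystanders`, `WaitOnly.cover_pair`).
Emitter and receiver thus meet, and every state of the saturation is coverable
(`WaitOnly.coverable_iff`).

To place the saturation in P, it is computed by a finite transducer that sweeps repeatedly over the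
input. Stacks simulate a sweep in linear time, so polynomially many sweeps suffice (`Sweeper.inP`).
The machine marks positions where names end, one kind of mark for derived names and one for declared
names. A round first derives marks inside single transitions, which needs only finite memory, and
then copies the mark of each position `h` to all positions where the same name of the same sort
ends. Equality of names is tested everywhere at once: the set of positions whose unfinished name
equals the one at `h` determines, by a shift by one cell, the same set for `h + 1` (`agree_eq`).

A word of length `n` has `n + 1` positions, so `n + 1` rounds reach a fixed point (`iterate_fixed`),
and there the derived marks are exactly the saturation (`roundM_sound`, `roundM_complete`). The same
sweeps detect violations of the Wait-Only condition, and a last one checks that all names are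
declared and that the queried state is derived (`good_iff`). The number of sweeps is quadratic. -/

/-- The saturation of an initial state under the transitions, where a reception is enabled as
soon as some state in the saturation sends or broadcasts its message. -/
inductive Saturated {α β : Type*} (i : α) (T : Set (α × Op β × α)) : α → Prop
  | init : Saturated i T i
  | act {q a q'} : (q, a, q') ∈ T → a.IsAct → Saturated i T q → Saturated i T q'
  | recv {p m p' q a q'} : (p, Op.recv m, p') ∈ T → Saturated i T p →
      (q, a, q') ∈ T → (a = Op.send m ∨ a = Op.bcast m) → Saturated i T q → Saturated i T p'

/-! ### Coverability is saturation -/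

namespace Protocol

variable {α β : Type*} {P : Protocol α β}

/-- The states in the saturation of the initial state. -/
abbrev Derivable (P : Protocol α β) : α → Prop := Saturated P.init {t | t ∈ P.trans}

theorem _root_.Multiset.Rel.exists_mem_left {γ δ : Type*} {r : γ → δ → Prop} {s : Multiset γ}
    {t : Multiset δ} (h : Multiset.Rel r s t) {b : δ} (hb : b ∈ t) : ∃ a ∈ s, r a b :=
  Multiset.exists_mem_of_rel_of_mem (Multiset.rel_flip.2 h) hb

/-- A received message was emitted by a process of the same configuration, whose state is derivable,
so the reception is enabled in the saturation. The Wait-Only condition plays no role in this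
direction. -/
theorem derivable_of_fires {t : α × Op β × α} {C C' : Multiset α} (h : P.Fires t C C')
    (ht : t ∈ P.trans) (hC : ∀ q ∈ C, P.Derivable q) : ∀ q ∈ C', P.Derivable q := by
  cases h with
  | tau q q' D =>
    simp only [Multiset.mem_cons, forall_eq_or_imp] at hC ⊢
    exact ⟨.act ht trivial hC.1, hC.2⟩
  | bcast m q q' D D' h =>
    simp only [Multiset.mem_cons, forall_eq_or_imp] at hC ⊢
    refine ⟨.act ht trivial hC.1, fun p' hp' => ?_⟩
    obtain ⟨p, hp, hr⟩ := h.exists_mem_left hp'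
    rcases hr with ⟨-, rfl⟩ | hr
    · exact hC.2 _ hp
    · exact .recv hr (hC.2 _ hp) ht (.inr rfl) hC.1
  | sendAlone m q q' D h =>
    simp only [Multiset.mem_cons, forall_eq_or_imp] at hC ⊢
    exact ⟨.act ht trivial hC.1, hC.2⟩
  | rendezvous m q q' p p' D h =>
    simp only [Multiset.mem_cons, forall_eq_or_imp] at hC ⊢
    exact ⟨.act ht trivial hC.1, .recv h hC.2.1 ht (.inl rfl) hC.1, hC.2.2⟩

theorem Coverable.derivable {q : α} (h : P.Coverable q) : P.Derivable q := by
  obtain ⟨C, C', hC, hr, hq⟩ := h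
  suffices ∀ q ∈ C'.1, P.Derivable q from this q hq
  clear hq
  induction hr with
  | refl => exact fun q hq => hC q hq ▸ .init
  | tail _ hs ih => obtain ⟨t, ht, hf⟩ := hs; exact derivable_of_fires hf ht ih

/-- A process in the state `q` reacts to no message. -/
def Deaf (P : Protocol α β) (q : α) : Prop := ∀ m, ¬ P.CanRecv m q

/-- This is how the Wait-Only condition enters: a process that is ready to act can be kept in place
while others run. -/
theorem WaitOnly.deaf (hP : P.WaitOnly) {q q' : α} {a : Op β} (h : (q, a, q') ∈ P.trans)
    (ha : a.IsAct) : P.Deaf q := by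
  rintro m ⟨p, hp⟩
  rcases hP q (P.trans_mem _ _ _ h).1 with h' | h'
  · exact h' ⟨m, p, hp⟩
  · exact h' ⟨a, q', ha, h⟩

theorem Fires.mem_states {t : α × Op β × α} {C C' : Multiset α} (h : P.Fires t C C')
    (ht : t ∈ P.trans) (hC : ∀ q ∈ C, q ∈ P.states) : ∀ q ∈ C', q ∈ P.states := by
  have hm := (P.trans_mem _ _ _ ht).2.1
  cases h with
  | tau q q' D => simp_all
  | bcast m q q' D D' h =>
    simp only [Multiset.mem_cons, forall_eq_or_imp] at hC ⊢
    refine ⟨hm, fun p' hp' => ?_⟩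
    obtain ⟨p, hp, hr⟩ := h.exists_mem_left hp'
    rcases hr with ⟨-, rfl⟩ | hr
    · exact hC.2 _ hp
    · exact (P.trans_mem _ _ _ hr).2.1
  | sendAlone m q q' D h => simp_all
  | rendezvous m q q' p p' D h =>
    simp only [Multiset.mem_cons, forall_eq_or_imp] at hC ⊢
    exact ⟨hm, (P.trans_mem _ _ _ h).2.1, hC.2.2⟩

theorem Fires.ne_zero {t : α × Op β × α} {C C' : Multiset α} (h : P.Fires t C C') : C' ≠ 0 := by
  cases h <;> simp

/-- `P.Runs C C'` is reachability on plain multisets. -/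
def Runs (P : Protocol α β) : Multiset α → Multiset α → Prop :=
  Relation.ReflTransGen fun C C' => ∃ t ∈ P.trans, P.Fires t C C'

theorem Runs.coverable {C C' : Multiset α} (h : P.Runs C C') (hne : C ≠ 0)
    (hC : ∀ q ∈ C, q = P.init) {q : α} (hq : q ∈ C') : P.Coverable q := by
  have hCs : ∀ q ∈ C, q ∈ P.states := fun q hq => hC q hq ▸ P.init_mem
  suffices ∃ D : P.Config, D.1 = C' ∧ Relation.ReflTransGen P.Step ⟨C, hne, hCs⟩ D by
    obtain ⟨D, rfl, hD⟩ := this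
    exact ⟨⟨C, hne, hCs⟩, D, hC, hD, hq⟩
  clear hq
  induction h with
  | refl => exact ⟨_, rfl, .refl⟩
  | tail _ hs ih =>
    obtain ⟨t, ht, hf⟩ := hs
    obtain ⟨D, rfl, hD⟩ := ih
    exact ⟨⟨_, hf.ne_zero, hf.mem_states ht D.2.2⟩, rfl, hD.tail ⟨t, ht, hf⟩⟩

theorem Coverable.runs {q : α} (h : P.Coverable q) :
    ∃ C C', (∀ q ∈ C, q = P.init) ∧ P.Runs C C' ∧ q ∈ C' ∧ C ≠ 0 := by
  obtain ⟨C, C', hC, hr, hq⟩ := h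
  exact ⟨C.1, C'.1, hC, Relation.ReflTransGen.lift (r := P.Step) Subtype.val (fun _ _ h => h) _ _ hr, hq, C.2.1⟩

/-- How bystanders may evolve: those that are deaf stay where they are. -/
abbrev Drift (P : Protocol α β) : Multiset α → Multiset α → Prop :=
  Multiset.Rel fun p p' => P.Deaf p → p' = p

/-- No set of additional processes can block a step: they react to a broadcast if they can, and one
of them may pick up a request that had no receiver. Only processes able to receive are displaced. -/
theorem Fires.add_bystanders {t : α × Op β × α} {C C' : Multiset α} (h : P.Fires t C C')
    (E : Multiset α) : ∃ E', P.Fires t (C + E) (C' + E') ∧ P.Drift E E' := by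
  classical
  have hrefl : P.Drift E E := Multiset.rel_refl_of_refl_on fun _ _ _ => rfl
  cases h with
  | tau q q' D => exact ⟨E, by simpa using .tau q q' (D + E), hrefl⟩
  | bcast m q q' D D' h =>
    have hr : ∀ p, ∃ p', P.Reacts m p p' := fun p => by
      by_cases hp : P.CanRecv m p
      · obtain ⟨p', hp'⟩ := hp
        exact ⟨p', .inr hp'⟩
      · exact ⟨p, .inl ⟨hp, rfl⟩⟩
    choose f hf using hr
    refine ⟨E.map f, ?_, ?_⟩
    · have : Multiset.Rel (P.Reacts m) E (E.map f) := by
        rw [Multiset.rel_map_right]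
        exact Multiset.rel_refl_of_refl_on fun p _ => hf p
      simpa using Fires.bcast m q q' _ _ (h.add this)
    · rw [Drift, Multiset.rel_map_right]
      refine Multiset.rel_refl_of_refl_on fun p _ hd => ?_
      rcases hf p with h | h
      · exact h.2
      · exact absurd ⟨_, h⟩ (hd m)
  | sendAlone m q q' D h =>
    by_cases hE : ∀ p ∈ E, ¬ P.CanRecv m p
    · refine ⟨E, ?_, hrefl⟩
      have := Fires.sendAlone (P := P) m q q' (D + E)
        fun p hp => (Multiset.mem_add.1 hp).elim (h p) (hE p)
      simpa using this
    -- A bystander that can receive rules out `sendAlone`, so it becomes the receiver; not being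
    -- deaf, it is allowed to move by `Drift`.
    · push Not at hE
      obtain ⟨p, hp, p', hp'⟩ := hE
      obtain ⟨F, rfl⟩ := Multiset.exists_cons_of_mem hp
      refine ⟨p' ::ₘ F, ?_, ?_⟩
      · simpa [Multiset.cons_swap] using Fires.rendezvous m q q' p p' (D + F) hp'
      · exact .cons (fun hd => absurd ⟨_, hp'⟩ (hd m))
          (Multiset.rel_refl_of_refl_on fun _ _ _ => rfl)
  | rendezvous m q q' p p' D h =>
    exact ⟨E, by simpa using Fires.rendezvous m q q' p p' (D + E) h, hrefl⟩

theorem Runs.add_bystanders {C C' : Multiset α} (h : P.Runs C C') (E : Multiset α) :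
    ∃ E', P.Runs (C + E) (C' + E') ∧ P.Drift E E' := by
  induction h with
  | refl => exact ⟨E, .refl, Multiset.rel_refl_of_refl_on fun _ _ _ => rfl⟩
  | tail _ hs ih =>
    obtain ⟨t, ht, hf⟩ := hs
    obtain ⟨E', hr, hd⟩ := ih
    obtain ⟨E'', hf', hd'⟩ := hf.add_bystanders E'
    refine ⟨E'', hr.tail ⟨t, ht, hf'⟩, ?_⟩
    -- `Drift` is transitive: a deaf process that stays where it is remains deaf.
    clear hr hf' hf
    induction hd generalizing E'' with
    | zero => simpa using hd'
    | cons h1 h2 ih =>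
      obtain ⟨b, bs, hb, hbs, rfl⟩ := Multiset.rel_cons_left.1 hd'
      refine .cons (fun hd => ?_) (ih _ hbs)
      have := h1 hd
      subst this
      exact hb hd

theorem Drift.mem {E E' : Multiset α} (h : P.Drift E E') {q : α} (hq : q ∈ E) (hd : P.Deaf q) :
    q ∈ E' := by
  obtain ⟨q', hq', he⟩ := Multiset.exists_mem_of_rel_of_mem h hq
  exact he hd ▸ hq'

theorem Drift.eq_of_deaf {E E' : Multiset α} (h : P.Drift E E') (hd : ∀ q ∈ E, P.Deaf q) :
    E' = E := by
  induction h with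
  | zero => rfl
  | cons h1 _ ih =>
    rw [h1 (hd _ (Multiset.mem_cons_self _ _)), ih fun q hq => hd q (Multiset.mem_cons_of_mem hq)]

/-- Every step needs a process that performs an action, and here all processes sit in a state
without one. -/
theorem Runs.eq_of_not_act {C C' : Multiset α} (h : P.Runs C C') (hC : ∀ q ∈ C, q = P.init)
    (hi : ∀ a q', a.IsAct → (P.init, a, q') ∉ P.trans) : C' = C := by
  induction h with
  | refl => rfl
  | tail _ hs ih =>
    obtain ⟨t, ht, hf⟩ := hs
    subst ih
    exfalso
    cases hf <;>
    · obtain rfl := hC _ (Multiset.mem_cons_self _ _)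
      refine hi _ _ ?_ ht
      trivial

/-- A coverable state with an outgoing action and another coverable state can be covered at the
same time. -/
theorem WaitOnly.cover_pair (hP : P.WaitOnly) {q p q' : α} {a : Op β} (hq : P.Coverable q)
    (ha : a.IsAct) (ht : (q, a, q') ∈ P.trans) (hp : P.Coverable p) :
    ∃ C F, C ≠ 0 ∧ (∀ q ∈ C, q = P.init) ∧ P.Runs C (q ::ₘ p ::ₘ F) := by
  obtain ⟨C₁, C₁', h₁, hr₁, hq, hne⟩ := hq.runs
  obtain ⟨C₂, C₂', h₂, hr₂, hp, -⟩ := hp.runs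
  -- If the initial state could receive, it would have no action, no step would ever fire, and `q`
  -- would be the initial state, against its outgoing action.
  have hdi : P.Deaf P.init := by
    by_contra hd
    have hi : ∀ a q', a.IsAct → (P.init, a, q') ∉ P.trans := fun a q' ha h => hd (hP.deaf h ha)
    rw [hr₁.eq_of_not_act h₁ hi] at hq
    obtain rfl := h₁ q hq
    exact hi _ _ ha ht
  obtain ⟨E, hE, hd⟩ := hr₁.add_bystanders C₂
  -- The second group waits in the deaf initial state, so it is intact when its own run begins.
  obtain rfl := hd.eq_of_deaf fun q hq => h₂ q hq ▸ hdi
  -- The order matters: `p` may be able to receive and is therefore covered last, while `q` is deaf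
  -- and survives the second run.
  obtain ⟨F, hF, hd'⟩ := hr₂.add_bystanders C₁'
  have hqF := hd'.mem hq (hP.deaf ht ha)
  obtain ⟨F', rfl⟩ := Multiset.exists_cons_of_mem hqF
  obtain ⟨G, rfl⟩ := Multiset.exists_cons_of_mem hp
  refine ⟨C₁ + E, G + F', by simp [hne], fun q hq => (Multiset.mem_add.1 hq).elim (h₁ q) (h₂ q), ?_⟩
  rw [add_comm] at hF
  have e : q ::ₘ p ::ₘ (G + F') = p ::ₘ G + q ::ₘ F' := by simp [Multiset.cons_swap q p]
  rw [e]
  exact hE.trans hF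

theorem WaitOnly.coverable_of_derivable (hP : P.WaitOnly) {q : α} (h : P.Derivable q) :
    P.Coverable q := by
  classical
  induction h with
  | init =>
    exact Runs.coverable (C := {P.init}) .refl (by simp) (by simp) (by simp)
  | @act q a q' ht ha _ ih =>
    obtain ⟨C, C', hC, hr, hq, hne⟩ := ih.runs
    obtain ⟨D, rfl⟩ := Multiset.exists_cons_of_mem hq
    -- The step is taken by an isolated process first; the rest of the configuration joins as
    -- bystanders.
    obtain ⟨X, hX⟩ : ∃ X, P.Fires (q, a, q') (q ::ₘ 0) (q' ::ₘ X) := by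
      cases a with
      | tau => exact ⟨0, .tau _ _ _⟩
      | bcast m => exact ⟨0, .bcast _ _ _ _ _ .zero⟩
      | send m => exact ⟨0, .sendAlone _ _ _ _ (by simp)⟩
      | recv m => exact ha.elim
    obtain ⟨E, hE, -⟩ := hX.add_bystanders D
    refine Runs.coverable (hr.tail ⟨_, ht, ?_⟩) hne hC (q := q') (C' := q' ::ₘ X + E) (by simp)
    simpa using hE
  | @recv p m p' q a q' htp _ htq ham _ ihp ihq =>
    have ha : a.IsAct := by rcases ham with rfl | rfl <;> trivial
    obtain ⟨C, F, hne, hC, hr⟩ := hP.cover_pair ihq ha htq ihp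
    obtain ⟨X, hX⟩ : ∃ X, P.Fires (q, a, q') (q ::ₘ p ::ₘ 0) (q' ::ₘ p' ::ₘ X) := by
      rcases ham with rfl | rfl
      · exact ⟨0, .rendezvous _ _ _ _ _ _ htp⟩
      · exact ⟨0, .bcast _ _ _ _ _ (.cons (.inr htp) .zero)⟩
    obtain ⟨E, hE, -⟩ := hX.add_bystanders F
    refine Runs.coverable (hr.tail ⟨_, htq, ?_⟩) hne hC (q := p') (C' := q' ::ₘ p' ::ₘ X + E)
      (by simp)
    simpa using hE

theorem WaitOnly.coverable_iff (hP : P.WaitOnly) {q : α} : P.Coverable q ↔ P.Derivable q :=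
  ⟨Coverable.derivable, hP.coverable_of_derivable⟩

end Protocol

/-! ### Sweeping machines

A sweeping machine repeats a left-to-right pass of a finite transducer over a tape that holds one
cell for each letter of the input and one more for the end of the input. -/

/-- A sweeping machine with input alphabet `Γ`, finite control `S` and cells `A`. -/
structure Sweeper (Γ S A : Type) where
  /-- the transducer -/
  trans : S → A → S × A
  /-- the initial cell of a letter, or of the end of the input -/
  cell : Option Γ → A
  /-- the initial state -/
  start : S
  /-- the answer given in a state, if any -/
  out : S → Option Bool

namespace Sweeper

variable {Γ S A : Type} (W : Sweeper Γ S A)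

/-- One pass over the tape. -/
def pass : S → List A → S × List A
  | v, [] => (v, [])
  | v, a :: l => ((pass (W.trans v a).1 l).1, (W.trans v a).2 :: (pass (W.trans v a).1 l).2)

@[simp]
theorem length_pass (v : S) (l : List A) : (W.pass v l).2.length = l.length := by
  induction l generalizing v with
  | nil => rfl
  | cons a l ih => simp [pass, ih]

/-- The initial tape. -/
def tape (w : List Γ) : List A := w.map (fun a => W.cell (some a)) ++ [W.cell none]

/-- The state and the tape after `k` passes. -/
def run (w : List Γ) (k : ℕ) : S × List A := (fun s => W.pass s.1 s.2)^[k] (W.start, W.tape w)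

/-- The stacks: input, output, and the parts of the tape left and right of the head. -/
inductive Stk
  | inp | out | left | right
  deriving DecidableEq

instance : Fintype Stk := ⟨{.inp, .out, .left, .right}, by rintro (_ | _ | _ | _) <;> simp⟩

/-- The stack alphabets. -/
abbrev Alph (Γ A : Type) : Stk → Type
  | .inp => Γ
  | .out => Bool
  | .left => A
  | .right => A

/-- The labels: reading the input, returning to the left end, passing, cleaning up. -/
inductive Lab
  | load | ret | fwd | clean
  deriving DecidableEq

instance : Fintype Lab := ⟨{Lab.load, Lab.ret, Lab.fwd, Lab.clean}, by rintro (_ | _ | _ | _) <;> simp⟩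

open Turing TM2.Stmt in
/-- The program of the stack machine that simulates a sweeping machine. -/
def code : Lab → TM2.Stmt (Alph Γ A) Lab (S × Option Γ × Option A)
  -- The push precedes the test, so the pop from the empty input writes the cell for the end of the
  -- word.
  | .load => pop .inp (fun v a => (v.1, a, none)) <| push .left (fun v => W.cell v.2.1) <|
      goto fun v => bif v.2.1.isSome then .load else .ret
  | .ret => pop .left (fun v a => (v.1, none, a)) <| branch (fun v => v.2.2.isSome)
      (push .right (fun v => v.2.2.getD (W.cell none)) <| goto fun _ => .ret)
      (goto fun _ => .fwd)
  | .fwd => pop .right (fun v a => a.elim (v.1, none, none)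
        fun a => ((W.trans v.1 a).1, none, some (W.trans v.1 a).2)) <|
      branch (fun v => v.2.2.isSome)
      (push .left (fun v => v.2.2.getD (W.cell none)) <| goto fun _ => .fwd)
      (goto fun v => bif (W.out v.1).isSome then .clean else .ret)
  -- `haltList` requires all stacks but the output to be empty and the register to be the initial
  -- one.
  | .clean => pop .left (fun v a => (v.1, none, a)) <| branch (fun v => v.2.2.isSome)
      (goto fun _ => .clean)
      (push .out (fun v => (W.out v.1).getD false) <| load (fun _ => (W.start, none, none)) halt)

/-- A choice of the contents of all stacks. -/
def stks (i : List Γ) (o : List Bool) (l r : List A) : ∀ k, List (Alph Γ A k)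
  | .inp => i
  | .out => o
  | .left => l
  | .right => r

@[simp] theorem update_inp (i i' : List Γ) (o : List Bool) (l r : List A) :
    Function.update (stks i o l r) .inp i' = stks i' o l r := by
  funext k; cases k <;> rfl

@[simp] theorem update_out (i : List Γ) (o o' : List Bool) (l r : List A) :
    Function.update (stks i o l r) .out o' = stks i o' l r := by
  funext k; cases k <;> rfl

@[simp] theorem update_left (i : List Γ) (o : List Bool) (l l' r : List A) :
    Function.update (stks i o l r) .left l' = stks i o l' r := by
  funext k; cases k <;> rfl

@[simp] theorem update_right (i : List Γ) (o : List Bool) (l r r' : List A) :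
    Function.update (stks i o l r) .right r' = stks i o l r' := by
  funext k; cases k <;> rfl

variable [Fintype Γ] [Fintype S] [Fintype A]

/-- The stack machine that simulates a sweeping machine. -/
def toTM2 : Turing.FinTM2 where
  K := Stk
  k₀ := .inp
  k₁ := .out
  Γ := Alph Γ A
  Λ := Lab
  main := .load
  σ := S × Option Γ × Option A
  initialState := (W.start, none, none)
  Γk₀Fin := inferInstanceAs (Fintype Γ)
  m := W.code

/-- A configuration of the stack machine. -/
def cfg (q : Option Lab) (v : S × Option Γ × Option A) (i : List Γ) (o : List Bool)
    (l r : List A) : W.toTM2.Cfg :=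
  (⟨q, v, stks i o l r⟩ : Turing.TM2.Cfg (Alph Γ A) Lab (S × Option Γ × Option A))

/-- `W.Leads c c' t`: from `c` the stack machine comes to `c'` in `t` steps. -/
def Leads (c c' : W.toTM2.Cfg) (t : ℕ) : Prop := (flip bind W.toTM2.step)^[t] (some c) = some c'

variable {W}

theorem Leads.trans {c c' c'' : W.toTM2.Cfg} {t t' : ℕ} (h : W.Leads c c' t)
    (h' : W.Leads c' c'' t') : W.Leads c c'' (t' + t) := by
  rw [Leads, Function.iterate_add_apply, h, h']

theorem Leads.head {q q' v v' i i' o o' l l' r r'} {c : W.toTM2.Cfg} {t : ℕ}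
    (h : Turing.TM2.stepAux (W.code q) v (stks i o l r) = ⟨q', v', stks i' o' l' r'⟩)
    (h' : W.Leads (W.cfg q' v' i' o' l' r') c t) :
    W.Leads (W.cfg (some q) v i o l r) c (t + 1) := by
  rw [Leads, Function.iterate_succ_apply]
  exact (congrArg _ (congrArg some h)).trans h'

variable (W)

/-- Only the control state `v.1` matters from phase to phase; the other registers hold leftover
symbols, hence the existential `v'`. -/
theorem leads_load (v) (i : List Γ) (l : List A) : ∃ v', v'.1 = v.1 ∧
    W.Leads (W.cfg (some .load) v i [] l []) (W.cfg (some .ret) v' [] [] ((W.tape i).reverse ++ l) [])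
      (i.length + 1) := by
  induction i generalizing v l with
  | nil =>
    refine ⟨(v.1, none, none), rfl, Leads.head ?_ rfl⟩
    simp [code, stks, tape]
  | cons a i ih =>
    obtain ⟨v', hv, h⟩ := ih (v.1, some a, none) (W.cell (some a) :: l)
    refine ⟨v', hv, Leads.head ?_ (by simpa [tape] using h)⟩
    simp [code, stks]

theorem leads_ret (v) (l r : List A) : ∃ v', v'.1 = v.1 ∧
    W.Leads (W.cfg (some .ret) v [] [] l r) (W.cfg (some .fwd) v' [] [] [] (l.reverse ++ r))
      (l.length + 1) := by
  induction l generalizing v r with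
  | nil =>
    refine ⟨(v.1, none, none), rfl, Leads.head ?_ rfl⟩
    simp [code, stks]
  | cons a l ih =>
    obtain ⟨v', hv, h⟩ := ih (v.1, none, some a) (a :: r)
    refine ⟨v', hv, Leads.head ?_ (by simpa using h)⟩
    simp [code, stks]

theorem leads_fwd (v) (l r : List A) : ∃ v', v'.1 = (W.pass v.1 r).1 ∧
    W.Leads (W.cfg (some .fwd) v [] [] l r)
      (W.cfg (some (bif (W.out (W.pass v.1 r).1).isSome then .clean else .ret)) v' [] []
        ((W.pass v.1 r).2.reverse ++ l) []) (r.length + 1) := by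
  induction r generalizing v l with
  | nil =>
    refine ⟨(v.1, none, none), rfl, Leads.head ?_ rfl⟩
    simp [code, stks, pass]
  | cons a r ih =>
    obtain ⟨v', hv, h⟩ := ih ((W.trans v.1 a).1, none, some (W.trans v.1 a).2)
      ((W.trans v.1 a).2 :: l)
    have e : (W.pass v.1 (a :: r)).2.reverse ++ l = (W.pass (W.trans v.1 a).1 r).2.reverse ++
        (W.trans v.1 a).2 :: l := by simp [pass]
    rw [e]
    refine ⟨v', hv, Leads.head ?_ h⟩
    simp [code, stks]

theorem leads_clean (v) (b : Bool) (hb : W.out v.1 = some b) (l : List A) :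
    W.Leads (W.cfg (some .clean) v [] [] l []) (W.cfg none (W.start, none, none) [] [b] [] [])
      (l.length + 1) := by
  induction l generalizing v with
  | nil =>
    refine Leads.head ?_ rfl
    simp [code, stks, hb]
  | cons a l ih =>
    refine Leads.head ?_ (ih (v.1, none, some a) hb)
    simp [code, stks]

/-- Rewinding, sweeping and the final cleaning each take one step per cell and one more to notice
the empty stack. -/
theorem leads_passes (k n : ℕ) (v) (T : List A) (hT : T.length = n) (b : Bool)
    (hk : W.out ((fun s => W.pass s.1 s.2)^[k + 1] (v.1, T)).1 = some b)
    (hlt : ∀ j, 0 < j → j < k + 1 → W.out ((fun s => W.pass s.1 s.2)^[j] (v.1, T)).1 = none) :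
    W.Leads (W.cfg (some .ret) v [] [] T.reverse []) (W.cfg none (W.start, none, none) [] [b] [] [])
      ((k + 1) * (2 * (n + 1)) + (n + 1)) := by
  induction k generalizing v T with
  | zero =>
    obtain ⟨v₁, h₁, l₁⟩ := W.leads_ret v T.reverse []
    obtain ⟨v₂, h₂, l₂⟩ := W.leads_fwd v₁ [] T
    have hk' : W.out (W.pass v.1 T).1 = some b := by simpa using hk
    rw [h₁, hk'] at l₂
    have l₃ := W.leads_clean v₂ b (by rw [h₂, h₁, hk']) (W.pass v.1 T).2.reverse
    simp only [List.reverse_reverse, List.append_nil, List.length_reverse] at l₁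
    simp only [Option.isSome_some, cond_true, List.append_nil] at l₂
    convert (l₁.trans l₂).trans l₃ using 1
    simp [hT]; ring
  | succ k ih =>
    obtain ⟨v₁, h₁, l₁⟩ := W.leads_ret v T.reverse []
    obtain ⟨v₂, h₂, l₂⟩ := W.leads_fwd v₁ [] T
    have hk' : W.out (W.pass v.1 T).1 = none := by simpa using hlt 1 one_pos (by omega)
    rw [h₁, hk'] at l₂
    rw [h₁] at h₂
    have l₃ := ih v₂ (W.pass v.1 T).2 (by simp [hT])
      (by rw [h₂]; rw [Function.iterate_succ_apply] at hk; exact hk)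
      (fun j hj hjk => by
        have := hlt (j + 1) (by omega) (by omega)
        rw [h₂]; rw [Function.iterate_succ_apply] at this; exact this)
    simp only [List.reverse_reverse, List.append_nil, List.length_reverse] at l₁
    simp only [Option.isSome_none, cond_false, List.append_nil] at l₂
    convert (l₁.trans l₂).trans l₃ using 1
    simp [hT]; ring

/-- If a sweeping machine answers correctly within polynomially many passes, and never changes an
answer, then its language is in P. -/
theorem inP {L : Language Γ} (p : Polynomial ℕ)
    (hout : ∀ v a b, W.out v = some b → W.out (W.trans v a).1 = some b)
    (hstart : W.out W.start = none)
    (h : ∀ w, ∃ k ≤ p.eval w.length, ∃ b, W.out (W.run w k).1 = some b ∧ (b = true ↔ w ∈ L)) :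
    InP L := by
  classical
  have hpass : ∀ l v b, W.out v = some b → W.out (W.pass v l).1 = some b := by
    intro l
    induction l with
    | nil => exact fun v b h => h
    | cons a l ih => exact fun v b h => ih _ _ (hout v a b h)
  have hmono : ∀ w j k b, j ≤ k → W.out (W.run w j).1 = some b → W.out (W.run w k).1 = some b := by
    intro w j k b hjk hj
    induction hjk with
    | refl => exact hj
    | step _ ih => rw [run, Function.iterate_succ_apply']; exact hpass _ _ _ ih
  -- The tape has one cell more than the input: a pass costs `2 * (n + 2)` steps, cleaning `n + 2`,
  -- and loading `n + 1`.
  refine ⟨⟨⟨W.toTM2, Equiv.refl _, Equiv.refl _⟩,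
    (p + 1) * (2 * (Polynomial.X + 2)) + (Polynomial.X + 2) + (Polynomial.X + 1), fun w =>
    Classical.choice ?_⟩⟩
  suffices ∃ t ≤ Polynomial.eval w.length
      ((p + 1) * (2 * (Polynomial.X + 2)) + (Polynomial.X + 2) + (Polynomial.X + 1)),
      W.Leads (Turing.initList W.toTM2 (List.map id w))
        (Turing.haltList W.toTM2 [decide (w ∈ L)]) t by
    obtain ⟨t, ht, h⟩ := this
    exact ⟨⟨⟨t, h⟩, ht⟩⟩
  have hex : ∃ k, (W.out (W.run w k).1).isSome := by
    obtain ⟨k, -, b, hk, -⟩ := h w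
    exact ⟨k, by simp [hk]⟩
  have hle : Nat.find hex ≤ p.eval w.length := by
    obtain ⟨k, hkp, b, hk, -⟩ := h w
    exact (Nat.find_min' hex (by simp [hk])).trans hkp
  have hval : W.out (W.run w (Nat.find hex)).1 = some (decide (w ∈ L)) := by
    obtain ⟨k, hkp, b, hk, hb⟩ := h w
    obtain ⟨b', hb'⟩ := Option.isSome_iff_exists.1 (Nat.find_spec hex)
    -- Answers are permanent, so the first one agrees with the correct one provided by `h`.
    have := hmono w _ k b' (Nat.find_min' hex (by simp [hk])) hb'
    rw [hb']
    rw [hk] at this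
    cases this
    rw [← Bool.decide_coe b]
    simp only [hb]
  -- The machine inspects its answer only after a pass; as the start state gives none, nothing is
  -- missed.
  obtain ⟨k, hk⟩ : ∃ k, Nat.find hex = k + 1 := by
    refine Nat.exists_eq_succ_of_ne_zero fun h0 => ?_
    rw [h0] at hval
    simp [run, hstart] at hval
  obtain ⟨v₁, h₁, l₁⟩ := W.leads_load (W.start, none, none) w []
  have l₂ := W.leads_passes k (w.length + 1) v₁ (W.tape w) (by simp [tape]) (decide (w ∈ L))
    (by rw [h₁, ← hk]; exact hval)
    (fun j _ hj => by
      rw [h₁]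
      exact Option.not_isSome_iff_eq_none.1 (Nat.find_min hex (hk ▸ hj)))
  rw [List.append_nil] at l₁
  have l₃ := l₁.trans l₂
  have e₁ : W.cfg (some .load) (W.start, none, none) w [] [] [] =
      Turing.initList W.toTM2 (List.map id w) := by
    unfold Turing.initList cfg
    congr 1
    funext q
    cases q
    · exact (List.map_id w).symm
    all_goals rfl
  have e₂ : W.cfg none (W.start, none, none) [] [decide (w ∈ L)] [] [] =
      Turing.haltList W.toTM2 [decide (w ∈ L)] := by
    unfold Turing.haltList cfg
    congr 1
    funext q
    cases q <;> rfl
  rw [e₁, e₂] at l₃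
  refine ⟨_, ?_, l₃⟩
  rw [hk] at hle
  simp only [Polynomial.eval_add, Polynomial.eval_mul, Polynomial.eval_X, Polynomial.eval_one,
    Polynomial.eval_ofNat]
  have : (k + 1) * (2 * (w.length + 1 + 1)) ≤ (p.eval w.length + 1) * (2 * (w.length + 2)) := by
    gcongr
    omega
  omega

end Sweeper

/-! ### Parsing -/

/-- The kinds of labels. -/
inductive Kind
  | tau | bcast | send | recv
  deriving DecidableEq

instance : Fintype Kind :=
  ⟨{.tau, .bcast, .send, .recv}, by rintro (_ | _ | _ | _) <;> simp⟩

/-- The label of a given kind, with a given message. -/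
def Kind.op {β : Type*} (m : β) : Kind → Op β
  | .tau => .tau
  | .bcast => .bcast m
  | .send => .send m
  | .recv => .recv m

/-- Whether a label of the given kind is not a reception. -/
def Kind.act : Kind → Bool
  | .recv => false
  | _ => true

@[simp]
theorem Kind.isAct_op {β : Type*} (m : β) (k : Kind) : (k.op m).IsAct ↔ k.act = true := by
  cases k <;> simp [Kind.op, Op.IsAct, Kind.act]

theorem Kind.eq_recv {β : Type*} {m m' : β} {k : Kind} (h : Op.recv m = k.op m') :
    k = .recv ∧ m' = m := by
  cases k <;> simp_all [Kind.op]

theorem Kind.eq_of_send_or_bcast {β : Type*} {m m' : β} {k : Kind}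
    (h : k.op m' = Op.send m ∨ k.op m' = Op.bcast m) : k.act = true ∧ m' = m ∧ k ≠ .tau := by
  cases k <;> simp_all [Kind.op, Kind.act]

/-- The states of the automaton that recognizes the descriptions: inside a state name, a message
name, the initial state, the source, the message or the target of a transition, the state in
question; and a rejecting sink. The flags tell whether the name read so far is non-empty. -/
inductive Pos
  | st (ne : Bool)
  | ms (ne : Bool)
  | ini
  | src (ne : Bool)
  | msg (k : Kind)
  | tgt (k : Kind)
  | qry
  | bad
  deriving DecidableEq, Fintype

/-- The transition function of the automaton. -/
def Pos.next : Pos → Sym → Pos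
  | .st _, .bit _ => .st true
  | .st _, .comma => .st false
  | .st false, .hash => .ms false
  | .ms _, .bit _ => .ms true
  | .ms _, .comma => .ms false
  | .ms false, .hash => .ini
  | .ini, .bit _ => .ini
  | .ini, .hash => .src false
  | .src _, .bit _ => .src true
  | .src false, .hash => .qry
  | .src _, .tau => .tgt .tau
  | .src _, .bcast => .msg .bcast
  | .src _, .send => .msg .send
  | .src _, .recv => .msg .recv
  | .msg k, .bit _ => .msg k
  | .msg k, .comma => .tgt k
  | .tgt k, .bit _ => .tgt k
  | .tgt _, .comma => .src false
  | .qry, .bit _ => .qry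
  | _, _ => .bad

/-- What has been read: the position, the current name, reversed, the source and the message of
the current transition, and the lists of states, messages, transitions, and the initial state. -/
structure Parsed where
  pos : Pos
  cur : Name
  src : Name
  msg : Name
  st : List Name
  ms : List Name
  ini : Name
  tr : List (Name × Op Name × Name)

namespace Parsed

/-- The current name. -/
def nm (s : Parsed) : Name := s.cur.reverse

/-- Nothing has been read. -/
def start : Parsed := ⟨.st false, [], [], [], [], [], [], []⟩

/-- Whether a state name ends. -/
def endsSt : Pos → Sym → Bool
  | .st _, .comma => true
  | _, _ => false

/-- Whether a message name ends. -/
def endsMs : Pos → Sym → Bool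
  | .ms _, .comma => true
  | _, _ => false

/-- Whether the initial state ends. -/
def endsIni : Pos → Sym → Bool
  | .ini, .hash => true
  | _, _ => false

/-- The kind of the transition that ends, if any. -/
def endsTr : Pos → Sym → Option Kind
  | .tgt k, .comma => some k
  | _, _ => none

/-- The current name after one more symbol, reversed. -/
def push (l : Name) : Sym → Name
  | .bit b => b :: l
  | _ => []

/-- The source of the current transition after one more symbol. -/
def nextSrc (s : Parsed) : Pos → Sym → Name
  | .src _, .bit _ => s.src
  | .src _, _ => s.nm
  | _, _ => s.src

/-- The message of the current transition after one more symbol. -/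
def nextMsg (s : Parsed) : Pos → Sym → Name
  | .src _, .tau => []
  | .msg _, .comma => s.nm
  | _, _ => s.msg

/-- Reading one more symbol. -/
def next (s : Parsed) (a : Sym) : Parsed where
  pos := s.pos.next a
  cur := push s.cur a
  src := s.nextSrc s.pos a
  msg := s.nextMsg s.pos a
  st := s.st ++ if endsSt s.pos a then [s.nm] else []
  ms := s.ms ++ if endsMs s.pos a then [s.nm] else []
  ini := if endsIni s.pos a then s.nm else s.ini
  tr := s.tr ++ (endsTr s.pos a).elim [] fun k => [(s.src, k.op s.msg, s.nm)]

/-- Whether the current name is empty. -/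
def Fresh (s : Parsed) (ne : Bool) : Prop := s.cur = [] ↔ ne = false

/-- The part of an operation that precedes its message. -/
def encodeKind : Kind → Sym
  | .tau => .tau
  | .bcast => .bcast
  | .send => .send
  | .recv => .recv

theorem encodeOp_op (k : Kind) (m : Name) : encodeOp (k.op m) =
    encodeKind k :: if k = .tau then [] else encodeName m ++ [.comma] := by
  cases k <;> simp [Kind.op, encodeOp, encodeKind]

/-- The text that has been read, if it has not been rejected. -/
def Text (s : Parsed) (w : List Sym) : Prop :=
  let S := encodeNames s.st
  let M := S ++ [Sym.hash] ++ encodeNames s.ms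
  let I := M ++ [Sym.hash] ++ encodeName s.ini
  let T := I ++ [Sym.hash] ++ encodeTrans s.tr
  match s.pos with
  | .st ne => s.Fresh ne ∧ s.ms = [] ∧ s.tr = [] ∧ w = S ++ encodeName s.nm
  | .ms ne => s.Fresh ne ∧ s.tr = [] ∧ w = M ++ encodeName s.nm
  | .ini => s.tr = [] ∧ w = M ++ [Sym.hash] ++ encodeName s.nm
  | .src ne => s.Fresh ne ∧ w = T ++ encodeName s.nm
  | .msg k => k ≠ .tau ∧ w = T ++ encodeName s.src ++ [encodeKind k] ++ encodeName s.nm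
  | .tgt k => (k = .tau → s.msg = []) ∧ w = T ++ encodeName s.src ++ encodeOp (k.op s.msg) ++ encodeName s.nm
  | .qry => w = T ++ [Sym.hash] ++ encodeName s.nm
  | .bad => True

/-- In the lists of states, messages and transitions a `hash` is accepted only when the current name
is empty; this is what the flags are for, since letters of an unfinished name would be lost
otherwise. -/
theorem text_next {s : Parsed} {w : List Sym} (h : s.Text w) (a : Sym) :
    (s.next a).Text (w ++ [a]) := by
  obtain ⟨pos, cur, src, msg, st, ms, ini, tr⟩ := s
  rcases pos with (ne | ne | _ | ne | k | k | _ | _) <;> rcases a with (b | _ | _ | _ | _ | _ | _) <;>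
    (try trivial) <;> (try cases ne) <;> (try trivial) <;>
    simp_all [Text, next, Pos.next, Fresh, nm, encodeNames, encodeName, encodeTrans, encodeOp_op,
      encodeKind, push, nextSrc, nextMsg, endsSt, endsMs, endsIni, endsTr]

/-- The result of reading a word. -/
def ofWord (w : List Sym) : Parsed := w.foldl next start

theorem text_ofWord (w : List Sym) : (ofWord w).Text w := by
  induction w using List.reverseRecOn with
  | nil => simp [ofWord, Text, start, Fresh, nm, encodeNames, encodeName]
  | append_singleton w a ih =>
    rw [ofWord, List.foldl_append]
    exact text_next ih a

/-- The word described by its ingredients. -/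
def word (ls lm : List Name) (ini : Name) (lt : List (Name × Op Name × Name)) (q : Name) :
    List Sym :=
  encodeNames ls ++ [Sym.hash] ++ encodeNames lm ++ [Sym.hash] ++ encodeName ini ++
      [Sym.hash] ++ encodeTrans lt ++ [Sym.hash] ++ encodeName q

/-- Together with `ofWord_word` this makes the format unambiguous: accepted words are exactly the
descriptions, and the ingredients are recovered by parsing. -/
theorem eq_word {w : List Sym} (h : (ofWord w).pos = .qry) : w = word (ofWord w).st (ofWord w).ms
    (ofWord w).ini (ofWord w).tr (ofWord w).nm := by
  have := text_ofWord w
  rw [Text, h] at this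
  exact this

/-- The position after a name. -/
def _root_.BroadcastNet.Pos.skip (p : Pos) (x : Name) : Pos :=
  x.foldl (fun p b => p.next (.bit b)) p

theorem foldl_encodeName (x : Name) (s : Parsed) : (encodeName x).foldl next s =
    { s with pos := s.pos.skip x, cur := x.reverse ++ s.cur } := by
  induction x generalizing s with
  | nil => rfl
  | cons b x ih =>
    rw [encodeName, List.map_cons, List.foldl_cons, ← encodeName, ih]
    obtain ⟨pos, cur, src, msg, st, ms, ini, tr⟩ := s
    rcases pos with (ne | ne | _ | ne | k | k | _ | _) <;>
      simp [next, push, nextSrc, nextMsg, endsSt, endsMs, endsIni, endsTr, Pos.skip]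

theorem skip_st (ne : Bool) (x : Name) : ∃ ne', (Pos.st ne).skip x = .st ne' := by
  induction x generalizing ne with
  | nil => exact ⟨ne, rfl⟩
  | cons b x ih => exact ih true

theorem skip_ms (ne : Bool) (x : Name) : ∃ ne', (Pos.ms ne).skip x = .ms ne' := by
  induction x generalizing ne with
  | nil => exact ⟨ne, rfl⟩
  | cons b x ih => exact ih true

theorem skip_src (ne : Bool) (x : Name) : ∃ ne', (Pos.src ne).skip x = .src ne' := by
  induction x generalizing ne with
  | nil => exact ⟨ne, rfl⟩
  | cons b x ih => exact ih true

@[simp]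
theorem skip_ini (x : Name) : Pos.ini.skip x = .ini := by
  induction x with
  | nil => rfl
  | cons b x ih => exact ih

@[simp]
theorem skip_msg (k : Kind) (x : Name) : (Pos.msg k).skip x = .msg k := by
  induction x with
  | nil => rfl
  | cons b x ih => exact ih

@[simp]
theorem skip_tgt (k : Kind) (x : Name) : (Pos.tgt k).skip x = .tgt k := by
  induction x with
  | nil => rfl
  | cons b x ih => exact ih

@[simp]
theorem skip_qry (x : Name) : Pos.qry.skip x = .qry := by
  induction x with
  | nil => rfl
  | cons b x ih => exact ih

theorem foldl_encodeNames_st (l : List Name) (src msg : Name) (st ms : List Name) (ini : Name)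
    (tr : List (Name × Op Name × Name)) :
    (encodeNames l).foldl next ⟨.st false, [], src, msg, st, ms, ini, tr⟩ =
      ⟨.st false, [], src, msg, st ++ l, ms, ini, tr⟩ := by
  induction l generalizing st with
  | nil => simp [encodeNames]
  | cons x l ih =>
    obtain ⟨ne, hne⟩ := skip_st false x
    rw [encodeNames, List.flatMap_cons, ← encodeNames, List.foldl_append, List.foldl_append,
      foldl_encodeName]
    simp [hne, next, push, nextSrc, nextMsg, endsSt, endsMs, endsIni, endsTr, Pos.next, nm, ih]

theorem foldl_encodeNames_ms (l : List Name) (src msg : Name) (st ms : List Name) (ini : Name)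
    (tr : List (Name × Op Name × Name)) :
    (encodeNames l).foldl next ⟨.ms false, [], src, msg, st, ms, ini, tr⟩ =
      ⟨.ms false, [], src, msg, st, ms ++ l, ini, tr⟩ := by
  induction l generalizing ms with
  | nil => simp [encodeNames]
  | cons x l ih =>
    obtain ⟨ne, hne⟩ := skip_ms false x
    rw [encodeNames, List.flatMap_cons, ← encodeNames, List.foldl_append, List.foldl_append,
      foldl_encodeName]
    simp [hne, next, push, nextSrc, nextMsg, endsSt, endsMs, endsIni, endsTr, Pos.next, nm, ih]

theorem foldl_encodeTrans (l : List (Name × Op Name × Name)) (src msg : Name) (st ms : List Name)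
    (ini : Name) (tr : List (Name × Op Name × Name)) : ∃ src' msg',
    (encodeTrans l).foldl next ⟨.src false, [], src, msg, st, ms, ini, tr⟩ =
      ⟨.src false, [], src', msg', st, ms, ini, tr ++ l⟩ := by
  induction l generalizing tr src msg with
  | nil => exact ⟨src, msg, by simp [encodeTrans]⟩
  | cons t l ih =>
    obtain ⟨q, a, q'⟩ := t
    obtain ⟨ne, hne⟩ := skip_src false q
    obtain ⟨k, m, ha⟩ : ∃ (k : Kind) (m : Name), a = k.op m ∧ (k = .tau → m = []) := by
      rcases a with _ | m | m | m
      exacts [⟨.tau, [], rfl, fun _ => rfl⟩, ⟨.bcast, m, rfl, by simp⟩, ⟨.send, m, rfl, by simp⟩,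
        ⟨.recv, m, rfl, by simp⟩]
    obtain ⟨src', msg', h⟩ := ih q m (tr ++ [(q, a, q')])
    refine ⟨src', msg', ?_⟩
    rw [encodeTrans, List.flatMap_cons, ← encodeTrans, List.foldl_append, List.foldl_append,
      List.foldl_append, List.foldl_append, foldl_encodeName]
    obtain ⟨rfl, hm⟩ := ha
    cases k <;>
    simp_all [foldl_encodeName, next, push, nextSrc, nextMsg, endsSt, endsMs, endsIni, endsTr,
      Pos.next, nm, encodeOp, Kind.op]

theorem ofWord_word (ls lm : List Name) (ini : Name) (lt : List (Name × Op Name × Name))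
    (q : Name) : ∃ src msg,
    ofWord (word ls lm ini lt q) = ⟨.qry, q.reverse, src, msg, ls, lm, ini, lt⟩ := by
  obtain ⟨src, msg, h⟩ := foldl_encodeTrans lt [] [] ls lm ini []
  -- The last `hash` is read in a `src` position with an empty name, which resets the source
  -- register.
  refine ⟨[], msg, ?_⟩
  simp only [ofWord, word, List.foldl_append, start, foldl_encodeNames_st]
  simp [next, push, nextSrc, nextMsg, endsSt, endsMs, endsIni, endsTr, Pos.next,
    foldl_encodeNames_ms, foldl_encodeName, nm, h]

/-! ### The language in terms of parsed data -/

/-- Whether the parsed data form a Wait-Only protocol together with a coverable state of it. -/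
structure Good (s : Parsed) : Prop where
  ini_mem : s.ini ∈ s.st
  src_mem : ∀ q a q', (q, a, q') ∈ s.tr → q ∈ s.st
  tgt_mem : ∀ q a q', (q, a, q') ∈ s.tr → q' ∈ s.st
  msg_mem : ∀ q a q' m, (q, a, q') ∈ s.tr → a.msg = some m → m ∈ s.ms
  qry_mem : s.nm ∈ s.st
  waitOnly : ∀ q m q₁ a q₂, (q, Op.recv m, q₁) ∈ s.tr → (q, a, q₂) ∈ s.tr → ¬ a.IsAct
  saturated : Saturated s.ini {t | t ∈ s.tr} s.nm

-- Unique parsing removes the existential quantifier over protocols, and `WaitOnly.coverable_iff`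
-- replaces coverability by saturation.
open Classical in
theorem mem_stateCoverWaitOnly (w : List Sym) :
    w ∈ stateCoverWaitOnly ↔ (ofWord w).pos = .qry ∧ (ofWord w).Good := by
  constructor
  · rintro ⟨P, q, hq, ⟨ls, lm, lt, hs, hm, ht, rfl⟩, hw, hc⟩
    obtain ⟨src, msg, h⟩ := ofWord_word ls lm P.init lt q
    rw [word] at h
    rw [h]
    have hT : {t | t ∈ lt} = {t | t ∈ P.trans} := Set.ext ht
    refine ⟨rfl, (hs _).2 P.init_mem, ?_, ?_, ?_, ?_, ?_, ?_⟩
    · exact fun q a q' h => (hs _).2 (P.trans_mem _ _ _ ((ht _).1 h)).1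
    · exact fun q a q' h => (hs _).2 (P.trans_mem _ _ _ ((ht _).1 h)).2.1
    · exact fun q a q' m h he => (hm _).2 ((P.trans_mem _ _ _ ((ht _).1 h)).2.2 m he)
    · simpa [nm, hs] using hq
    · intro q m q₁ a q₂ h₁ h₂ ha
      exact hw.deaf ((ht _).1 h₂) ha m ⟨q₁, (ht _).1 h₁⟩
    · have := hc.derivable
      rw [Protocol.Derivable, ← hT] at this
      rwa [nm, List.reverse_reverse]
  · rintro ⟨hp, h⟩
    have hw := eq_word hp
    generalize ofWord w = s at hp h hw
    let P : Protocol Name Name :=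
      { states := s.st.toFinset
        messages := s.ms.toFinset
        init := s.ini
        trans := s.tr.toFinset
        init_mem := by simpa using h.ini_mem
        trans_mem := fun q a q' ht => by
          rw [List.mem_toFinset] at ht
          simpa using ⟨h.src_mem _ _ _ ht, h.tgt_mem _ _ _ ht, fun m => h.msg_mem _ _ _ m ht⟩ }
    have hwo : P.WaitOnly := by
      intro q _
      by_contra hcon
      push Not at hcon
      obtain ⟨⟨m, q₁, h₁⟩, a, q₂, ha, h₂⟩ := hcon
      exact h.waitOnly q m q₁ a q₂ (List.mem_toFinset.1 h₁) (List.mem_toFinset.1 h₂) ha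
    refine ⟨P, s.nm, List.mem_toFinset.2 h.qry_mem, ⟨s.st, s.ms, s.tr, ?_, ?_, ?_, hw⟩, hwo,
      hwo.coverable_iff.2 ?_⟩
    · exact fun _ => List.mem_toFinset.symm
    · exact fun _ => List.mem_toFinset.symm
    · exact fun _ => List.mem_toFinset.symm
    · have hT : {t | t ∈ P.trans} = {t | t ∈ s.tr} := Set.ext fun _ => List.mem_toFinset
      simpa [Protocol.Derivable, hT] using h.saturated

end Parsed

/-! ### Saturation by marks on positions -/

/-- The sort of the name that ends with a given symbol (or with the end of the word) at a given
position: `true` for states, `false` for messages. -/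
def sort : Pos → Option Sym → Option Bool
  | .st _, some .comma => some true
  | .ini, some .hash => some true
  | .src _, some .tau => some true
  | .src _, some .bcast => some true
  | .src _, some .send => some true
  | .src _, some .recv => some true
  | .tgt _, some .comma => some true
  | .qry, none => some true
  | .ms _, some .comma => some false
  | .msg _, some .comma => some false
  | _, _ => none

/-- Whether a declaration of a state or a message ends here. -/
def isDecl : Pos → Option Sym → Bool
  | .st _, some .comma => true
  | .ms _, some .comma => true
  | _, _ => false

/-- The register for the mark of the current source, after one more cell with mark `m`. -/
def srcReg : Pos → Bool → Bool → Bool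
  | .src _, m, _ => m
  | _, _, r => r

/-- The register for the mark of the current message, after one more cell with mark `m`. -/
def msgReg : Pos → Bool → Bool → Bool
  | .msg _, m, _ => m
  | _, _, r => r

/-- Whether a cell gets a mark because of the transition that it belongs to, given the marks of
the source and of the message. -/
def fires : Pos → Option Sym → Bool → Bool → Bool
  | .ini, some .hash, _, _ => true
  | .msg k, some .comma, r, _ => k.act && r
  | .tgt k, some .comma, r, r' => r && (k.act || r')
  | _, _, _, _ => false

/-- The symbols that end the source of a transition which is a reception, respectively which is
not. -/
def clash : Pos → Option Sym → Pos → Option Sym → Bool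
  | .src _, some .recv, .src _, some .tau => true
  | .src _, some .recv, .src _, some .bcast => true
  | .src _, some .recv, .src _, some .send => true
  | _, _, _, _ => false

/-- What has been read before a position; the end of the word ends a name. -/
def scan (w : List Sym) : ℕ → Parsed
  | 0 => .start
  | i + 1 => match w[i]? with
    | some a => (scan w i).next a
    | none => { scan w i with cur := [] }

/-! ### Parsed data read off from positions -/

namespace Scan

variable {w : List Sym}

theorem scan_succ {i : ℕ} {a : Sym} (h : w[i]? = some a) : scan w (i + 1) = (scan w i).next a := by
  rw [scan, h]

variable (w)

theorem scan_eq_ofWord {i : ℕ} (hi : i ≤ w.length) : scan w i = Parsed.ofWord (w.take i) := by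
  induction i with
  | zero => rfl
  | succ i ih =>
    have : w[i]? = some w[i] := List.getElem?_eq_getElem hi
    rw [scan_succ this, ih (by omega), Parsed.ofWord, Parsed.ofWord, List.take_add_one, this,
      List.foldl_append]
    rfl

theorem scan_length : scan w w.length = Parsed.ofWord w := by
  rw [scan_eq_ofWord w le_rfl, List.take_length]

variable {w}

theorem lt_length {i : ℕ} {a : Sym} (h : w[i]? = some a) : i < w.length :=
  (List.getElem?_eq_some_iff.1 h).1

theorem exists_sym {i : ℕ} (h : i < w.length) : ∃ a, w[i]? = some a :=
  ⟨_, List.getElem?_eq_getElem h⟩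

/-- A finite control cannot store the parsed lists; here and in the next two lemmas they are traded
for positions of the word where an item ends. -/
theorem mem_st {n : ℕ} (hn : n ≤ w.length) {x : Name} : x ∈ (scan w n).st ↔
    ∃ i < n, ∃ a, w[i]? = some a ∧ Parsed.endsSt (scan w i).pos a ∧ (scan w i).nm = x := by
  induction n with
  | zero => simp [scan, Parsed.start]
  | succ n ih =>
    obtain ⟨a, ha⟩ := exists_sym (show n < w.length from hn)
    simp only [Nat.lt_succ_iff_lt_or_eq, or_and_right, exists_or, exists_eq_left, ← ih (by omega),
      scan_succ ha, Parsed.next, List.mem_append, ha, Option.some.injEq, exists_eq_left']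
    cases Parsed.endsSt (scan w n).pos a <;> simp [eq_comm]

theorem mem_ms {n : ℕ} (hn : n ≤ w.length) {x : Name} : x ∈ (scan w n).ms ↔
    ∃ i < n, ∃ a, w[i]? = some a ∧ Parsed.endsMs (scan w i).pos a ∧ (scan w i).nm = x := by
  induction n with
  | zero => simp [scan, Parsed.start]
  | succ n ih =>
    obtain ⟨a, ha⟩ := exists_sym (show n < w.length from hn)
    simp only [Nat.lt_succ_iff_lt_or_eq, or_and_right, exists_or, exists_eq_left, ← ih (by omega),
      scan_succ ha, Parsed.next, List.mem_append, ha, Option.some.injEq, exists_eq_left']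
    cases Parsed.endsMs (scan w n).pos a <;> simp [eq_comm]

theorem mem_tr {n : ℕ} (hn : n ≤ w.length) {t : Name × Op Name × Name} : t ∈ (scan w n).tr ↔
    ∃ i < n, ∃ k, (scan w i).pos = .tgt k ∧ w[i]? = some .comma ∧
      t = ((scan w i).src, k.op (scan w i).msg, (scan w i).nm) := by
  induction n with
  | zero => simp [scan, Parsed.start]
  | succ n ih =>
    obtain ⟨a, ha⟩ := exists_sym (show n < w.length from hn)
    simp only [Nat.lt_succ_iff_lt_or_eq, or_and_right, exists_or, exists_eq_left, ← ih (by omega),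
      scan_succ ha, Parsed.next, List.mem_append, ha, Option.some.injEq]
    generalize (scan w n).pos = p
    cases p <;> cases a <;> simp [Parsed.endsTr]

/-- The order of the positions in a description. -/
def rank : Pos → ℕ
  | .st _ => 0
  | .ms _ => 1
  | .ini => 2
  | .src _ => 3
  | .msg _ => 3
  | .tgt _ => 3
  | .qry => 4
  | .bad => 5

/-- The sections come in a fixed order and rejection is final. Hence the initial state is recorded
only once, and no prefix of an accepted word is rejected. -/
theorem rank_next (p : Pos) (a : Sym) : rank p ≤ rank (p.next a) := by
  rcases p with (_ | _) | (_ | _) | _ | (_ | _) | _ | _ | _ | _ <;> cases a <;> simp [Pos.next, rank]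

theorem rank_mono {i j : ℕ} (h : i ≤ j) : rank (scan w i).pos ≤ rank (scan w j).pos := by
  induction h with
  | refl => rfl
  | @step j _ ih =>
    refine ih.trans ?_
    rw [scan]
    cases w[j]? with
    | none => rfl
    | some a => exact rank_next _ _

theorem ini_eq {i j : ℕ} (hj : j ≤ w.length) (hij : i < j) (hp : (scan w i).pos = .ini)
    (ha : w[i]? = some .hash) : (scan w j).ini = (scan w i).nm := by
  induction hij with
  | refl => simp [scan_succ ha, Parsed.next, hp, Parsed.endsIni]
  | @step j hij ih =>
    obtain ⟨a, hja⟩ := exists_sym (show j < w.length from hj)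
    have h3 : 3 ≤ rank (scan w j).pos := by
      refine le_trans ?_ (rank_mono hij)
      simp [scan_succ ha, Parsed.next, hp, Pos.next, rank]
    rw [scan_succ hja, ← ih (by omega)]
    have : Parsed.endsIni (scan w j).pos a = false := by
      generalize (scan w j).pos = p at h3
      cases p <;> simp [rank] at h3 <;> rfl
    simp [Parsed.next, this]

theorem exists_ini {n : ℕ} (hn : n ≤ w.length) (h3 : 3 ≤ rank (scan w n).pos)
    (h4 : rank (scan w n).pos ≤ 4) : ∃ i < n, (scan w i).pos = .ini ∧ w[i]? = some .hash := by
  induction n with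
  | zero => simp [scan, Parsed.start, rank] at h3
  | succ n ih =>
    obtain ⟨a, ha⟩ := exists_sym (show n < w.length from hn)
    by_cases h : 3 ≤ rank (scan w n).pos
    · obtain ⟨i, hi, h⟩ := ih (by omega) h ((rank_mono (by omega)).trans h4)
      exact ⟨i, by omega, h⟩
    · refine ⟨n, by omega, ?_⟩
      rw [scan_succ ha, Parsed.next] at h3 h4
      simp only at h3 h4
      rw [ha]
      generalize (scan w n).pos = p at *
      rcases p with (_ | _) | (_ | _) | _ | (_ | _) | _ | _ | _ | _ <;> cases a <;>
        simp_all [Pos.next, rank]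

section Accepted

variable (hw : (scan w w.length).pos = .qry)

include hw

theorem rank_le_four {i : ℕ} (hi : i ≤ w.length) : rank (scan w i).pos ≤ 4 := by
  have := rank_mono (w := w) hi
  rwa [hw] at this

/-- Backward induction from the end: since the word is accepted, only bits or the closing comma can
follow, so the transition gets listed. -/
theorem tgt_complete {i : ℕ} (hi : i ≤ w.length) {k : Kind} (hp : (scan w i).pos = .tgt k) :
    ∃ y, ((scan w i).src, k.op (scan w i).msg, y) ∈ (scan w w.length).tr := by
  induction hi using Nat.decreasingInduction with
  | self => rw [hw] at hp; cases hp
  | of_succ i hi ih =>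
    obtain ⟨a, ha⟩ := exists_sym hi
    have h4 := rank_le_four hw (show i + 1 ≤ w.length from hi)
    rw [scan_succ ha] at ih h4
    cases a with
    | bit b => simpa [Parsed.next, hp, Pos.next, Parsed.nextSrc, Parsed.nextMsg] using ih
    | comma => exact ⟨_, (mem_tr le_rfl).2 ⟨i, hi, k, hp, ha, rfl⟩⟩
    | _ => simp [Parsed.next, hp, Pos.next, rank] at h4

theorem msg_complete {i : ℕ} (hi : i ≤ w.length) {k : Kind} (hp : (scan w i).pos = .msg k) :
    ∃ m y, ((scan w i).src, k.op m, y) ∈ (scan w w.length).tr := by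
  induction hi using Nat.decreasingInduction with
  | self => rw [hw] at hp; cases hp
  | of_succ i hi ih =>
    obtain ⟨a, ha⟩ := exists_sym hi
    have h4 := rank_le_four hw (show i + 1 ≤ w.length from hi)
    have ht := fun k => tgt_complete hw (show i + 1 ≤ w.length from hi) (k := k)
    rw [scan_succ ha] at ih h4 ht
    cases a with
    | bit b => simpa [Parsed.next, hp, Pos.next, Parsed.nextSrc, Parsed.nextMsg] using ih
    | comma => exact ⟨_, by simpa [Parsed.next, hp, Pos.next, Parsed.nextSrc] using ht k⟩
    | _ => simp [Parsed.next, hp, Pos.next, rank] at h4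

theorem msg_complete' {i : ℕ} {k : Kind} (hp : (scan w i).pos = .msg k)
    (ha : w[i]? = some .comma) :
    ∃ y, ((scan w i).src, k.op (scan w i).nm, y) ∈ (scan w w.length).tr := by
  have ht := tgt_complete hw (show i + 1 ≤ w.length from lt_length ha) (k := k)
  rw [scan_succ ha] at ht
  simpa [Parsed.next, hp, Pos.next, Parsed.nextSrc, Parsed.nextMsg] using ht

theorem src_complete {i : ℕ} {k : Kind} {ne : Bool} (hp : (scan w i).pos = .src ne)
    (ha : w[i]? = some (Parsed.encodeKind k)) :
    ∃ m y, ((scan w i).nm, k.op m, y) ∈ (scan w w.length).tr := by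
  have ht := tgt_complete hw (show i + 1 ≤ w.length from lt_length ha) (k := k)
  have hm := msg_complete hw (show i + 1 ≤ w.length from lt_length ha) (k := k)
  rw [scan_succ ha] at ht hm
  cases k
  · exact ⟨_, by simpa [Parsed.next, hp, Pos.next, Parsed.nextSrc, Parsed.encodeKind] using ht⟩
  all_goals simpa [Parsed.next, hp, Pos.next, Parsed.nextSrc, Parsed.encodeKind] using hm

end Accepted

theorem exists_msg {i : ℕ} (hi : i ≤ w.length) {k : Kind} (hk : k ≠ .tau)
    (hp : (scan w i).pos = .tgt k) : ∃ j < i, (scan w j).pos = .msg k ∧ w[j]? = some .comma ∧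
      (scan w j).nm = (scan w i).msg ∧ (scan w j).src = (scan w i).src := by
  induction i with
  | zero => simp [scan, Parsed.start] at hp
  | succ i ih =>
    obtain ⟨a, ha⟩ := exists_sym (show i < w.length from hi)
    rw [scan_succ ha] at hp ⊢
    simp only [Parsed.next] at hp ⊢
    rcases h : (scan w i).pos with (_ | _) | (_ | _) | _ | (_ | _) | k' | k' | _ | _ <;> cases a <;>
      simp only [h, Pos.next, Pos.tgt.injEq, reduceCtorEq] at hp <;> (try exact absurd hp.symm hk)
    · subst hp
      exact ⟨i, by omega, h, ha, rfl, rfl⟩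
    · subst hp
      obtain ⟨j, hj, h⟩ := ih (by omega) h
      exact ⟨j, by omega, h⟩

theorem exists_src {i : ℕ} (hi : i ≤ w.length) {k : Kind}
    (hp : (scan w i).pos = .tgt k ∨ (scan w i).pos = .msg k) : ∃ j < i, ∃ ne,
      (scan w j).pos = .src ne ∧ w[j]? = some (Parsed.encodeKind k) ∧
      (scan w j).nm = (scan w i).src := by
  induction i with
  | zero => simp [scan, Parsed.start] at hp
  | succ i ih =>
    obtain ⟨a, ha⟩ := exists_sym (show i < w.length from hi)
    rw [scan_succ ha] at hp ⊢
    simp only [Parsed.next] at hp ⊢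
    rcases h : (scan w i).pos with ne | (_ | _) | _ | ne | k' | k' | _ | _ <;>
      rcases a with b | _ | _ | _ | _ | _ | _ <;> (try cases ne) <;>
      simp only [h, Pos.next, Pos.tgt.injEq, Pos.msg.injEq, reduceCtorEq, or_false, false_or] at hp <;>
      subst hp <;>
      first
      | exact ⟨i, by omega, _, h, ha, rfl⟩
      | (obtain ⟨j, hj, h⟩ := ih (by omega) (by simp [h])
         exact ⟨j, by omega, h⟩)

end Scan

/-! ### Rounds of marking and their fixed points -/

namespace Scan

open Finset

/-- An inflationary bounded operation on sets of numbers reaches a fixed point. -/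
theorem iterate_fixed {F : Finset ℕ → Finset ℕ} {n : ℕ} (h : ∀ s, s ⊆ F s)
    (hb : ∀ s ⊆ range n, F s ⊆ range n) {s : Finset ℕ} (hs : s ⊆ range n) :
    F (F^[n] s) = F^[n] s := by
  have hbk : ∀ k, F^[k] s ⊆ range n := fun k => by
    induction k with
    | zero => exact hs
    | succ k ih => rw [Function.iterate_succ_apply']; exact hb _ ih
  -- Until a fixed point is met, each application adds at least one element.
  have key : ∀ k, F (F^[k] s) = F^[k] s ∨ k ≤ #(F^[k] s) := fun k => by
    induction k with
    | zero => exact .inr (Nat.zero_le _)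
    | succ k ih =>
      rw [Function.iterate_succ_apply']
      by_cases hk : F (F^[k] s) = F^[k] s
      · exact .inl (by rw [hk, hk])
      · have := card_lt_card ((h (F^[k] s)).ssubset_of_ne (Ne.symm hk))
        rcases ih with ih | ih
        · exact absurd ih hk
        · exact .inr (by omega)
  rcases key n with hn | hn
  · exact hn
  · have he := eq_of_subset_of_card_le (hbk n) (by simpa using hn)
    exact ((hb _ (hbk n)).trans he.ge).antisymm (h _)

variable (w : List Sym)

/-- The position, as a state of the automaton. -/
abbrev pos (i : ℕ) : Pos := (scan w i).pos

/-- The same name of the same sort ends at both positions. -/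
def Same (x h : ℕ) : Prop :=
  sort (pos w x) w[x]? ≠ none ∧ sort (pos w x) w[x]? = sort (pos w h) w[h]? ∧
    (scan w x).cur = (scan w h).cur

instance (x h : ℕ) : Decidable (Same w x h) := by unfold Same; infer_instance

/-- Marking the positions where the same name ends as at the position `h`, if that is marked. -/
def spread (h : ℕ) (M : Finset ℕ) : Finset ℕ :=
  M ∪ {x ∈ range (w.length + 1) | Same w x h ∧ h ∈ M}

/-- Spreading the marks of the positions before `h`. -/
def spreads : ℕ → Finset ℕ → Finset ℕ
  | 0, M => M
  | h + 1, M => spread w h (spreads h M)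

/-- The registers for the marks of the source and the message of the current transition. -/
def regs (M : Finset ℕ) : ℕ → Bool × Bool
  | 0 => (false, false)
  | i + 1 => (srcReg (pos w i) (decide (i ∈ M)) (regs M i).1,
      msgReg (pos w i) (decide (i ∈ M)) (regs M i).2)

/-- Marking what is derived inside single transitions. -/
def derive (M : Finset ℕ) : Finset ℕ :=
  M ∪ {x ∈ range (w.length + 1) | fires (pos w x) w[x]? (regs w M x).1 (regs w M x).2}

/-- Marking the declarations. -/
def declare (V : Finset ℕ) : Finset ℕ :=
  V ∪ {x ∈ range (w.length + 1) | isDecl (pos w x) w[x]?}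

/-- One round of marking derived names. -/
def roundM (M : Finset ℕ) : Finset ℕ := spreads w (w.length + 1) (derive w M)

/-- One round of marking declared names. -/
def roundV (V : Finset ℕ) : Finset ℕ := spreads w (w.length + 1) (declare w V)

variable {w}

theorem mem_spread {h x : ℕ} {M : Finset ℕ} :
    x ∈ spread w h M ↔ x ∈ M ∨ (x ≤ w.length ∧ Same w x h ∧ h ∈ M) := by
  simp [spread]

theorem mem_derive {x : ℕ} {M : Finset ℕ} : x ∈ derive w M ↔
    x ∈ M ∨ (x ≤ w.length ∧ fires (pos w x) w[x]? (regs w M x).1 (regs w M x).2) := by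
  simp [derive]

theorem mem_declare {x : ℕ} {V : Finset ℕ} : x ∈ declare w V ↔
    x ∈ V ∨ (x ≤ w.length ∧ isDecl (pos w x) w[x]?) := by
  simp [declare]

theorem subset_spreads (n : ℕ) (M : Finset ℕ) : M ⊆ spreads w n M := by
  induction n with
  | zero => rfl
  | succ n ih => exact ih.trans subset_union_left

theorem spreads_subset_range (n : ℕ) {M : Finset ℕ} (hM : M ⊆ range (w.length + 1)) :
    spreads w n M ⊆ range (w.length + 1) := by
  induction n with
  | zero => exact hM
  | succ n ih => exact union_subset ih (filter_subset _ _)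

theorem subset_roundM (M : Finset ℕ) : M ⊆ roundM w M :=
  subset_union_left.trans (subset_spreads _ _)

theorem subset_roundV (V : Finset ℕ) : V ⊆ roundV w V :=
  subset_union_left.trans (subset_spreads _ _)

theorem roundM_subset_range {M : Finset ℕ} (hM : M ⊆ range (w.length + 1)) :
    roundM w M ⊆ range (w.length + 1) :=
  spreads_subset_range _ (union_subset hM (filter_subset _ _))

theorem roundV_subset_range {V : Finset ℕ} (hV : V ⊆ range (w.length + 1)) :
    roundV w V ⊆ range (w.length + 1) :=
  spreads_subset_range _ (union_subset hV (filter_subset _ _))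

/-- Closed sets of marks. -/
def Closed (w : List Sym) (M : Finset ℕ) : Prop :=
  ∀ x h, x ≤ w.length → h ≤ w.length → Same w x h → h ∈ M → x ∈ M

/-- The mark of `h'` is present when its turn comes and is copied to `x` then; later turns only add
marks. -/
theorem closed_of_spreads {M N : Finset ℕ} (hM : N ⊆ M) (h : spreads w (w.length + 1) M ⊆ N) :
    Closed w M := by
  intro x h' hx hh' hs hm
  have : ∀ n, h' < n → x ∈ spreads w n M := by
    intro n hn
    induction hn with
    | refl => exact mem_spread.2 (.inr ⟨hx, hs, subset_spreads _ _ hm⟩)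
    | step _ ih => exact mem_spread.2 (.inl ih)
  exact hM (h (this (w.length + 1) (by omega)))

/-- A property of positions that holds at the marked positions after spreading. -/
theorem spreads_sound {p : ℕ → Prop} (hp : ∀ x h, Same w x h → p h → p x) (n : ℕ) {M : Finset ℕ}
    (hM : ∀ x ∈ M, p x) : ∀ x ∈ spreads w n M, p x := by
  induction n with
  | zero => exact hM
  | succ n ih =>
    intro x hx
    rcases mem_spread.1 hx with hx | ⟨-, hs, hm⟩
    · exact ih x hx
    · exact hp x n hs (ih n hm)

theorem Same.nm_eq {x h : ℕ} (hs : Same w x h) : (scan w x).nm = (scan w h).nm :=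
  congrArg List.reverse hs.2.2

/-! #### Declared names -/

/-- What a mark for a declared name means. -/
def Declared (w : List Sym) (x : ℕ) : Prop :=
  (sort (pos w x) w[x]? = some true → (scan w x).nm ∈ (scan w w.length).st) ∧
    (sort (pos w x) w[x]? = some false → (scan w x).nm ∈ (scan w w.length).ms)

theorem Declared.same {x h : ℕ} (hs : Same w x h) (hh : Declared w h) : Declared w x := by
  rw [Declared, hs.nm_eq, hs.2.1]
  exact hh

theorem isDecl_iff {p : Pos} {a : Option Sym} : isDecl p a = true ↔
    ∃ b, a = some b ∧ ((Parsed.endsSt p b ∧ sort p a = some true) ∨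
      (Parsed.endsMs p b ∧ sort p a = some false)) := by
  rcases a with _ | a
  · cases p <;> simp [isDecl]
  · cases p <;> cases a <;> simp [isDecl, Parsed.endsSt, Parsed.endsMs, sort]

theorem sort_of_endsSt {p : Pos} {a : Sym} (h : Parsed.endsSt p a) : sort p (some a) = some true := by
  unfold Parsed.endsSt at h
  split at h
  · rfl
  · cases h

theorem sort_of_endsMs {p : Pos} {a : Sym} (h : Parsed.endsMs p a) :
    sort p (some a) = some false := by
  unfold Parsed.endsMs at h
  split at h
  · rfl
  · cases h

theorem declared_of_isDecl {x : ℕ} (h : isDecl (pos w x) w[x]?) : Declared w x := by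
  obtain ⟨b, hb, ⟨h, hs⟩ | ⟨h, hs⟩⟩ := isDecl_iff.1 h
  · refine ⟨fun _ => (mem_st le_rfl).2 ⟨x, lt_length hb, b, hb, h, rfl⟩, fun h' => ?_⟩
    simp [hs] at h'
  · refine ⟨fun h' => ?_, fun _ => (mem_ms le_rfl).2 ⟨x, lt_length hb, b, hb, h, rfl⟩⟩
    simp [hs] at h'

theorem roundV_sound {V : Finset ℕ} (hV : ∀ x ∈ V, Declared w x) :
    ∀ x ∈ roundV w V, Declared w x := by
  refine spreads_sound (fun x h => Declared.same) _ fun x hx => ?_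
  rcases mem_declare.1 hx with hx | ⟨-, hx⟩
  exacts [hV x hx, declared_of_isDecl hx]

/-- A fixed point contains the position of the declaration itself and is closed under copying to
other occurrences of the name. -/
theorem roundV_complete {V : Finset ℕ} (hV : roundV w V = V) {x : ℕ} (hx : x ≤ w.length)
    (hs : sort (pos w x) w[x]? ≠ none) (h : Declared w x) : x ∈ V := by
  have hsub : declare w V ⊆ V := (subset_spreads _ _).trans hV.le
  have he : declare w V = V := hsub.antisymm subset_union_left
  have hcl : Closed w V := closed_of_spreads (N := V) le_rfl (by
    have := hV.le
    rwa [roundV, he] at this)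
  have hdecl : ∀ i ≤ w.length, isDecl (pos w i) w[i]? → i ∈ V := fun i hi h =>
    hsub (mem_declare.2 (.inr ⟨hi, h⟩))
  rcases hb : sort (pos w x) w[x]? with _ | _ | _
  · exact absurd hb hs
  · obtain ⟨i, hi, a, ha, he, hn⟩ := (mem_ms le_rfl).1 (h.2 hb)
    have hsi : sort (pos w i) w[i]? = some false := by
      rw [ha, sort_of_endsMs he]
    exact hcl x i hx hi.le ⟨hs, by rw [hb, hsi], (List.reverse_injective hn).symm⟩
      (hdecl i hi.le (isDecl_iff.2 ⟨a, ha, .inr ⟨he, hsi⟩⟩))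
  · obtain ⟨i, hi, a, ha, he, hn⟩ := (mem_st le_rfl).1 (h.1 hb)
    have hsi : sort (pos w i) w[i]? = some true := by
      rw [ha, sort_of_endsSt he]
    exact hcl x i hx hi.le ⟨hs, by rw [hb, hsi], (List.reverse_injective hn).symm⟩
      (hdecl i hi.le (isDecl_iff.2 ⟨a, ha, .inl ⟨he, hsi⟩⟩))

/-! #### Derived names -/

section Accepted

variable (hw : pos w w.length = .qry)

/-- The transitions that have been read. -/
abbrev trs (w : List Sym) : Set (Name × Op Name × Name) := {t | t ∈ (scan w w.length).tr}

/-- The saturation. -/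
abbrev Sat (w : List Sym) : Name → Prop := Saturated (scan w w.length).ini (trs w)

/-- A message that is sent or broadcast in a state of the saturation. -/
def Avail (w : List Sym) (m : Name) : Prop :=
  ∃ q a q', (q, a, q') ∈ trs w ∧ (a = Op.send m ∨ a = Op.bcast m) ∧ Sat w q

/-- What a mark for a derived name means. -/
def Derived (w : List Sym) (x : ℕ) : Prop :=
  (sort (pos w x) w[x]? = some true → Sat w (scan w x).nm) ∧
    (sort (pos w x) w[x]? = some false → Avail w (scan w x).nm)

theorem Derived.same {x h : ℕ} (hs : Same w x h) (hh : Derived w h) : Derived w x := by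
  rw [Derived, hs.nm_eq, hs.2.1]
  exact hh

theorem pos_ne_msg_tau {i : ℕ} (hi : i ≤ w.length) : pos w i ≠ .msg .tau := by
  intro h
  have := Parsed.text_ofWord (w.take i)
  rw [← scan_eq_ofWord w hi, Parsed.Text, show (scan w i).pos = .msg .tau from h] at this
  exact this.1 rfl

/-- Inside the message or target of a transition, the last cell in a `src` position is where its
source name ended. The message register is claimed to be meaningful for receptions only; after a
`tau` it may be left over from an earlier transition. -/
theorem regs_sound {M : Finset ℕ} (hM : ∀ x ∈ M, Derived w x) {i : ℕ} (hi : i ≤ w.length) :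
    ((regs w M i).1 = true → ∀ k, pos w i = .msg k ∨ pos w i = .tgt k → Sat w (scan w i).src) ∧
    ((regs w M i).2 = true → pos w i = .tgt .recv → Avail w (scan w i).msg) := by
  induction i with
  | zero => simp [regs]
  | succ i ih =>
    obtain ⟨a, ha⟩ := exists_sym (show i < w.length from hi)
    have hD := hM i
    rw [Derived, ha] at hD
    obtain ⟨ih₁, ih₂⟩ := ih (by omega)
    rw [pos, scan_succ ha]
    simp only [pos, Parsed.next, regs] at ih₁ ih₂ hD ⊢
    refine ⟨fun hr k hk => ?_, fun hr hk => ?_⟩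
    · rcases h : (scan w i).pos with ne | (_ | _) | _ | ne | k' | k' | _ | _ <;>
        rcases a with b | _ | _ | _ | _ | _ | _ <;> (try cases ne) <;>
        simp only [h, Pos.next, Pos.tgt.injEq, Pos.msg.injEq, reduceCtorEq, or_false, false_or,
          or_self] at hk <;>
        rw [h] at hr hD <;>
        first
        | exact (hD (of_decide_eq_true hr)).1 rfl
        | exact ih₁ hr k' (by simp [h])
    · rcases h : (scan w i).pos with ne | (_ | _) | _ | ne | k' | k' | _ | _ <;>
        rcases a with b | _ | _ | _ | _ | _ | _ <;> (try cases ne) <;>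
        simp only [h, Pos.next, Pos.tgt.injEq, reduceCtorEq] at hk <;>
        rw [h] at hr hD <;>
        first
        | exact (hD (of_decide_eq_true hr)).2 rfl
        | exact ih₂ hr (by rw [h, hk])

include hw

/-- A message is marked before its transition has been read completely; acceptance of the word
guarantees that the transition is listed in the end. -/
theorem derive_sound {M : Finset ℕ} (hM : ∀ x ∈ M, Derived w x) :
    ∀ x ∈ derive w M, Derived w x := by
  intro x hx
  rcases mem_derive.1 hx with hx | ⟨hxw, hx⟩
  · exact hM x hx
  · obtain ⟨h₁, h₂⟩ := regs_sound hM hxw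
    rcases ha : w[x]? with _ | a
    · rw [ha] at hx
      rcases h : pos w x <;> simp [fires, h] at hx
    · have hlt := lt_length ha
      rw [ha] at hx
      rw [Derived, ha]
      rcases h : pos w x with ne | ne | _ | ne | k | k | _ | _ <;>
        rcases a with b | _ | _ | _ | _ | _ | _ <;>
        simp only [fires, h, Bool.false_eq_true, Bool.and_eq_true, Bool.or_eq_true] at hx
      · simp only [sort, Option.some.injEq, forall_const, Bool.true_eq_false, false_imp_iff, and_true]
        rw [← ini_eq le_rfl hlt h ha]
        exact .init
      · simp only [sort, Option.some.injEq, forall_const, Bool.false_eq_true, false_imp_iff, true_and]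
        obtain ⟨y, hy⟩ := msg_complete' hw h ha
        refine ⟨_, _, y, hy, ?_, h₁ hx.2 k (.inl h)⟩
        have := pos_ne_msg_tau hxw
        cases k
        · exact absurd h this
        · exact .inr rfl
        · exact .inl rfl
        · simp [Kind.act] at hx
      · simp only [sort, Option.some.injEq, forall_const, Bool.true_eq_false, false_imp_iff, and_true]
        have ht : ((scan w x).src, k.op (scan w x).msg, (scan w x).nm) ∈ trs w :=
          (mem_tr le_rfl).2 ⟨x, hlt, k, h, ha, rfl⟩
        have hs := h₁ hx.1 k (.inr h)
        rcases hk : k.act with _ | _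
        · have : k = .recv := by cases k <;> simp_all [Kind.act]
          subst this
          obtain ⟨q, a, q', ht', ha', hq⟩ := h₂ (by simpa [hk] using hx.2) h
          exact .recv ht hs ht' ha' hq
        · exact .act ht ((Kind.isAct_op _ _).2 hk) hs

theorem roundM_sound {M : Finset ℕ} (hM : ∀ x ∈ M, Derived w x) :
    ∀ x ∈ roundM w M, Derived w x :=
  spreads_sound (fun _ _ => Derived.same) _ (derive_sound hw hM)

omit hw

theorem regs_complete {M : Finset ℕ} {i : ℕ} (hi : i ≤ w.length) :
    (∀ k, pos w i = .msg k ∨ pos w i = .tgt k →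
      (∀ x ≤ w.length, sort (pos w x) w[x]? = some true → (scan w x).nm = (scan w i).src → x ∈ M) →
      (regs w M i).1 = true) ∧
    (pos w i = .tgt .recv →
      (∀ x ≤ w.length, sort (pos w x) w[x]? = some false → (scan w x).nm = (scan w i).msg → x ∈ M) →
      (regs w M i).2 = true) := by
  induction i with
  | zero =>
    refine ⟨fun k hk => ?_, fun hk => ?_⟩
    · simp [pos, scan, Parsed.start] at hk
    · simp [pos, scan, Parsed.start] at hk
  | succ i ih =>
    obtain ⟨a, ha⟩ := exists_sym (show i < w.length from hi)
    obtain ⟨ih₁, ih₂⟩ := ih (by omega)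
    rw [pos, scan_succ ha]
    simp only [Parsed.next, regs]
    refine ⟨fun k hk hM => ?_, fun hk hM => ?_⟩
    · rcases h : (scan w i).pos with ne | (_ | _) | _ | ne | k' | k' | _ | _ <;>
        rcases a with b | _ | _ | _ | _ | _ | _ <;> (try cases ne) <;>
        simp only [h, Pos.next, Pos.tgt.injEq, Pos.msg.injEq, reduceCtorEq, or_false, false_or,
          or_self] at hk <;>
        rw [h] at hM <;> rw [pos, h] <;>
        first
        | exact decide_eq_true (hM i (by omega) (by rw [pos, h, ha]; rfl) rfl)
        | exact ih₁ k' (by simp [pos, h]) hM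
    · rcases h : (scan w i).pos with ne | (_ | _) | _ | ne | k' | k' | _ | _ <;>
        rcases a with b | _ | _ | _ | _ | _ | _ <;> (try cases ne) <;>
        simp only [h, Pos.next, Pos.tgt.injEq, reduceCtorEq] at hk <;>
        rw [h] at hM <;> rw [pos, h] <;>
        first
        | exact decide_eq_true (hM i (by omega) (by rw [pos, h, ha]; rfl) rfl)
        | exact ih₂ (by rw [pos, h, hk]) hM

include hw

/-- By induction on the saturation: the name is marked at the place where the deriving step writes
it, and closure carries the mark to all its occurrences. For a reception the mark passes from the
emitting source to its message, then to the message of the reception, then to the target. -/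
theorem roundM_complete {M : Finset ℕ} (hM : roundM w M = M) {y : Name} (hy : Sat w y) :
    ∀ x ≤ w.length, sort (pos w x) w[x]? = some true → (scan w x).nm = y → x ∈ M := by
  have hsub : derive w M ⊆ M := (subset_spreads _ _).trans hM.le
  have he : derive w M = M := hsub.antisymm subset_union_left
  have hcl : Closed w M := closed_of_spreads (N := M) le_rfl (by
    have := hM.le
    rwa [roundM, he] at this)
  have hder : ∀ i ≤ w.length, fires (pos w i) w[i]? (regs w M i).1 (regs w M i).2 → i ∈ M :=
    fun i hi h => hsub (mem_derive.2 (.inr ⟨hi, h⟩))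
  have hspread : ∀ (i : ℕ) (b : Bool), i ≤ w.length → sort (pos w i) w[i]? = some b → i ∈ M →
      ∀ x ≤ w.length, sort (pos w x) w[x]? = some b → (scan w x).nm = (scan w i).nm → x ∈ M :=
    fun i b hi hs hm x hx hs' hn =>
      hcl x i hx hi ⟨by simp [hs'], by rw [hs, hs'], List.reverse_injective hn⟩ hm
  induction hy with
  | init =>
    obtain ⟨i, hi, hp, ha⟩ := exists_ini (w := w) le_rfl (by
      rw [show (scan w w.length).pos = .qry from hw]; simp [rank]) (rank_le_four hw le_rfl)
    have hp' : pos w i = .ini := hp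
    rw [ini_eq le_rfl hi hp ha]
    exact hspread i true hi.le (by rw [hp', ha]; rfl)
      (hder i hi.le (by rw [hp', ha]; rfl))
  | @act q a q' ht hact _ ih =>
    obtain ⟨i, hi, k, hp, ha, heq⟩ := (mem_tr le_rfl).1 ht
    simp only [Prod.mk.injEq] at heq
    obtain ⟨rfl, rfl, rfl⟩ := heq
    have hp' : pos w i = .tgt k := hp
    refine hspread i true hi.le (by rw [hp', ha]; rfl) (hder i hi.le ?_)
    rw [hp', ha]
    simp [fires, (Kind.isAct_op _ _).1 hact, (regs_complete hi.le).1 k (.inr hp) ih]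
  | @recv p m p' q a q' ht _ ht' ham _ ihp ihq =>
    obtain ⟨i, hi, k, hp, ha, heq⟩ := (mem_tr le_rfl).1 ht
    obtain ⟨j, hj, k', hp', ha', heq'⟩ := (mem_tr le_rfl).1 ht'
    simp only [Prod.mk.injEq] at heq heq'
    obtain ⟨rfl, hkm, rfl⟩ := heq
    obtain ⟨rfl, rfl, rfl⟩ := heq'
    obtain ⟨rfl, rfl⟩ := Kind.eq_recv hkm
    obtain ⟨hk, hm, hkt⟩ := Kind.eq_of_send_or_bcast ham
    obtain ⟨l, hl, hpl, hal, hnl, hsl⟩ := exists_msg hj.le hkt hp'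
    have hll : l ≤ w.length := by omega
    have hpl' : pos w l = .msg k' := hpl
    have hlM : l ∈ M := by
      refine hder l hll ?_
      rw [hpl', hal]
      simp [fires, hk, (regs_complete hll).1 k' (.inl hpl) (by rw [hsl]; exact ihq)]
    have hmsg := hspread l false hll (by rw [hpl', hal]; rfl) hlM
    rw [hnl, hm] at hmsg
    have hpi : pos w i = .tgt .recv := hp
    refine hspread i true hi.le (by rw [hpi, ha]; rfl) (hder i hi.le ?_)
    rw [hpi, ha]
    simp [fires, (regs_complete hi.le).1 .recv (.inr hp) ihp, (regs_complete hi.le).2 hp hmsg]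

end Accepted

/-! #### The decision -/

/-- The source of a reception and the source of an action with the same name end here. -/
def Clash (w : List Sym) (x h : ℕ) : Prop :=
  clash (pos w x) w[x]? (pos w h) w[h]? ∧ (scan w x).cur = (scan w h).cur

instance (x h : ℕ) : Decidable (Clash w x h) := by unfold Clash; infer_instance

/-- Whether two sources violate the Wait-Only condition. -/
def Clashes (w : List Sym) : Prop := ∃ h < w.length + 1, ∃ x < w.length + 1, Clash w x h

instance : Decidable (Clashes w) := by unfold Clashes; infer_instance

theorem clash_iff {p p' : Pos} {a a' : Option Sym} : clash p a p' a' = true ↔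
    ∃ ne ne' k, p = .src ne ∧ p' = .src ne' ∧ a = some .recv ∧
      a' = some (Parsed.encodeKind k) ∧ k.act = true := by
  constructor
  · intro h
    unfold clash at h
    split at h
    · exact ⟨_, _, .tau, rfl, rfl, rfl, rfl, rfl⟩
    · exact ⟨_, _, .bcast, rfl, rfl, rfl, rfl, rfl⟩
    · exact ⟨_, _, .send, rfl, rfl, rfl, rfl, rfl⟩
    · cases h
  · rintro ⟨ne, ne', k, rfl, rfl, rfl, rfl, hk⟩
    cases k <;> simp_all [clash, Parsed.encodeKind, Kind.act]

/-- The positions with a sort are the ends of all names in use, so a single condition on `V`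
expresses every membership requirement. The queried state ends with the word, hence `w.length ∈ M`.
-/
theorem good_iff (hw : pos w w.length = .qry) {M V : Finset ℕ}
    (hM : ∀ x ∈ M, Derived w x) (hM' : roundM w M = M)
    (hV : ∀ x ∈ V, Declared w x) (hV' : roundV w V = V) :
    (scan w w.length).Good ↔ ¬ Clashes w ∧
      (∀ x < w.length + 1, sort (pos w x) w[x]? ≠ none → x ∈ V) ∧ w.length ∈ M := by
  have hend : sort (pos w w.length) w[w.length]? = some true := by
    rw [hw]; simp [sort]
  constructor
  · intro hg
    refine ⟨?_, ?_, roundM_complete hw hM' hg.saturated _ le_rfl hend rfl⟩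
    · rintro ⟨h, hh, x, hx, hc, hn⟩
      obtain ⟨ne, ne', k, hp, hp', ha, ha', hk⟩ := clash_iff.1 hc
      obtain ⟨m, y, h₁⟩ := src_complete hw (k := .recv) hp ha
      obtain ⟨m', y', h₂⟩ := src_complete hw hp' ha'
      rw [Parsed.nm, hn] at h₁
      exact hg.waitOnly _ _ _ _ _ h₁ h₂ ((Kind.isAct_op _ _).2 hk)
    · intro x hx hs
      have hx : x ≤ w.length := by omega
      refine roundV_complete hV' hx hs ?_
      rcases ha : w[x]? with _ | a
      · obtain rfl : x = w.length := by
          rw [List.getElem?_eq_none_iff] at ha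
          omega
        exact ⟨fun _ => hg.qry_mem, fun h => by rw [hend] at h; cases h⟩
      · have hlt := lt_length ha
        have hsrc : ∀ k ne, pos w x = .src ne → a = Parsed.encodeKind k →
            (scan w x).nm ∈ (scan w w.length).st := by
          rintro k ne hp rfl
          obtain ⟨m, y, h⟩ := src_complete hw hp ha
          exact hg.src_mem _ _ _ h
        rw [Declared, ha]
        rw [ha] at hs
        rcases h : pos w x with ne | ne | _ | ne | k | k | _ | _ <;>
          rcases a with b | _ | _ | _ | _ | _ | _ <;> simp only [sort, h, ne_eq, not_true] at hs ⊢ <;>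
          simp only [Option.some.injEq, forall_const, Bool.true_eq_false, Bool.false_eq_true,
            false_imp_iff, and_true, true_and]
        · exact (mem_st le_rfl).2 ⟨x, hlt, _, ha, by rw [show (scan w x).pos = _ from h]; rfl, rfl⟩
        · exact (mem_ms le_rfl).2 ⟨x, hlt, _, ha, by rw [show (scan w x).pos = _ from h]; rfl, rfl⟩
        · rw [← ini_eq le_rfl hlt h ha]
          exact hg.ini_mem
        · exact hsrc .tau _ h rfl
        · exact hsrc .bcast _ h rfl
        · exact hsrc .send _ h rfl
        · exact hsrc .recv _ h rfl
        · obtain ⟨y, hy⟩ := msg_complete' hw h ha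
          have := pos_ne_msg_tau hx
          refine hg.msg_mem _ _ _ _ hy ?_
          cases k
          · exact absurd h this
          all_goals rfl
        · exact hg.tgt_mem _ _ _ ((mem_tr le_rfl).2 ⟨x, hlt, k, h, ha, rfl⟩)
  · rintro ⟨hc, hs, hm⟩
    have hst : ∀ x ≤ w.length, sort (pos w x) w[x]? = some true →
        (scan w x).nm ∈ (scan w w.length).st := fun x hx h =>
      (hV x (hs x (by omega) (by simp [h]))).1 h
    have hsrc : ∀ q a q', (q, a, q') ∈ (scan w w.length).tr → ∃ k m, a = Kind.op m k ∧
        ∃ j ≤ w.length, ∃ ne, pos w j = .src ne ∧ w[j]? = some (Parsed.encodeKind k) ∧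
          (scan w j).nm = q := by
      intro q a q' h
      obtain ⟨i, hi, k, hp, ha, heq⟩ := (mem_tr le_rfl).1 h
      simp only [Prod.mk.injEq] at heq
      obtain ⟨rfl, rfl, rfl⟩ := heq
      obtain ⟨j, hj, ne, h⟩ := exists_src hi.le (.inl hp)
      exact ⟨k, _, rfl, j, by omega, ne, h⟩
    refine ⟨?_, ?_, ?_, ?_, hst _ le_rfl hend, ?_, (hM _ hm).1 hend⟩
    · obtain ⟨i, hi, hp, ha⟩ := exists_ini (w := w) le_rfl (by
        rw [show (scan w w.length).pos = .qry from hw]; simp [rank]) (rank_le_four hw le_rfl)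
      rw [ini_eq le_rfl hi hp ha]
      exact hst i hi.le (by rw [show pos w i = _ from hp, ha]; rfl)
    · intro q a q' h
      obtain ⟨k, m, -, j, hj, ne, hp, ha, rfl⟩ := hsrc _ _ _ h
      exact hst j hj (by rw [hp, ha]; cases k <;> rfl)
    · intro q a q' h
      obtain ⟨i, hi, k, hp, ha, heq⟩ := (mem_tr le_rfl).1 h
      simp only [Prod.mk.injEq] at heq
      obtain ⟨rfl, rfl, rfl⟩ := heq
      exact hst i hi.le (by rw [show pos w i = _ from hp, ha]; rfl)
    · intro q a q' m h he
      obtain ⟨i, hi, k, hp, ha, heq⟩ := (mem_tr le_rfl).1 h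
      simp only [Prod.mk.injEq] at heq
      obtain ⟨rfl, rfl, rfl⟩ := heq
      obtain ⟨rfl, hk⟩ : (scan w i).msg = m ∧ k ≠ .tau := by
        cases k <;> simp_all [Kind.op, Op.msg]
      obtain ⟨j, hj, hpj, haj, hnj, -⟩ := exists_msg hi.le hk hp
      have hsj : sort (pos w j) w[j]? = some false := by
        rw [show pos w j = _ from hpj, haj]; rfl
      rw [← hnj]
      exact (hV j (hs j (by omega) (by simp [hsj]))).2 hsj
    · intro q m q₁ a q₂ h₁ h₂ hact
      obtain ⟨k, m₁, hk, j, hj, ne, hp, ha, rfl⟩ := hsrc _ _ _ h₁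
      obtain ⟨k', m₂, rfl, j', hj', ne', hp', ha', hn⟩ := hsrc _ _ _ h₂
      obtain ⟨rfl, -⟩ := Kind.eq_recv hk
      exact hc ⟨j', by omega, j, by omega, clash_iff.2 ⟨ne, ne', k', hp, hp', ha, ha',
        (Kind.isAct_op _ _).1 hact⟩, (List.reverse_injective hn).symm⟩

end Scan

/-! ### The sweeping machine -/

deriving instance DecidableEq for Sym

instance : Fintype Sym :=
  ⟨{.bit true, .bit false, .comma, .hash, .tau, .bcast, .send, .recv},
    by rintro ((_ | _) | _ | _ | _ | _ | _ | _) <;> simp⟩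

/-- A cell of the tape: a symbol, the marks of derived and of declared names, whether the cell is
the position of a walker, of the inner and of the outer counter. -/
structure Cell where
  sym : Option Sym
  derived : Bool
  declared : Bool
  walker : Bool
  inner : Bool
  outer : Bool
  deriving Fintype

/-- What is remembered of the cell where the inner counter is. -/
structure Head where
  sym : Option Sym
  pos : Pos
  derived : Bool
  declared : Bool
  deriving Fintype

set_option synthInstance.maxSize 1000 in
/-- The control states: deriving names inside transitions, reading the cell of the inner counter,
spreading its marks, checking the result, and done. -/
inductive Ctl
  | derive (p : Pos) (walker inner outer r₁ r₂ clash : Bool)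
  | read (r : Head) (p : Pos) (clash : Bool)
  | spread (r : Head) (p : Pos) (walker inner clash : Bool)
  | check (p : Pos) (ok clash : Bool)
  | done (b : Bool)
  deriving Fintype

/-- Whether a name ends with the symbol, or with the end of the word. -/
def isEnd : Option Sym → Bool
  | some (.bit _) => false
  | _ => true

/-- The name that is being read after one more symbol or the end of the word, reversed. -/
def extend (l : Name) : Option Sym → Name
  | some a => Parsed.push l a
  | none => []

/-- Whether two names that are being read still agree after one more symbol of each, given
whether they agreed before. -/
def agree : Option Sym → Option Sym → Bool → Bool
  | some (.bit b), some (.bit b'), r => (b == b') && r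
  | some (.bit _), _, _ => false
  | _, a, _ => isEnd a

/-- This recursion lets finite memory compare names of unbounded length: equality after one more
symbol depends only on the two symbols and on the previous equality. -/
theorem agree_eq (a c : Option Sym) (l l' : Name) :
    agree a c (decide (l = l')) = decide (extend l c = extend l' a) := by
  rcases a with _ | (b | _ | _ | _ | _ | _ | _) <;> rcases c with _ | (b' | _ | _ | _ | _ | _ | _) <;>
    simp [agree, extend, Parsed.push, isEnd]
  rw [eq_comm, Bool.beq_comm, Bool.eq_iff_iff]
  simp

theorem isEnd_eq (a : Option Sym) (l : Name) : isEnd a = decide ([] = extend l a) := by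
  rcases a with _ | (b | _ | _ | _ | _ | _ | _) <;> simp [extend, Parsed.push, isEnd]

/-- Nothing is remembered. -/
def Head.blank : Head := ⟨none, .bad, false, false⟩

/-- The first position. -/
abbrev Pos.first : Pos := .st false

/-- The transducer. -/
def Ctl.step : Ctl → Cell → Ctl × Cell
  | .derive p wk inn out r₁ r₂ cl, c =>
    (match c.sym with
      | some a => .derive (p.next a) (isEnd c.sym) false c.outer (srcReg p c.derived r₁)
          (msgReg p c.derived r₂) cl
      | none => bif c.outer then .check .first true cl else .read .blank .first cl,
      ⟨c.sym, c.derived || fires p c.sym r₁ r₂, c.declared || isDecl p c.sym, wk, inn, out⟩)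
  | .read r p cl, c =>
    let r := bif c.inner then ⟨c.sym, p, c.derived, c.declared⟩ else r
    (match c.sym with
      | some a => .read r (p.next a) cl
      | none => .spread r .first (isEnd r.sym) false cl, c)
  | .spread r p wk inn cl, c =>
    let same := c.walker && (sort p c.sym != none && sort p c.sym == sort r.pos r.sym)
    let cl := cl || (clash p c.sym r.pos r.sym && c.walker)
    (match c.sym with
      | some a => .spread r (p.next a) (agree r.sym c.sym c.walker) c.inner cl
      | none => bif c.inner then .derive .first true true false false false cl
          else .read .blank .first cl,
      ⟨c.sym, c.derived || (same && r.derived), c.declared || (same && r.declared), wk, inn,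
        c.outer⟩)
  | .check p ok cl, c =>
    let ok := ok && (sort p c.sym == none || c.declared)
    (match c.sym with
      | some a => .check (p.next a) ok cl
      | none => .done (ok && !cl && p == .qry && c.derived), c)
  | .done b, c => (.done b, c)

/-- The sweeping machine that decides the coverability of states of Wait-Only protocols. -/
def sweeper : Sweeper Sym Ctl Cell where
  trans := Ctl.step
  cell a := ⟨a, false, false, false, false, false⟩
  start := .derive .first true true true false false false
  out
    | .done b => some b
    | _ => none

/-! ### Passes of the machine carry out the marking operations -/

namespace Scan

open Finset

variable (w : List Sym)

/-- A cell with given marks. -/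
def cell (M V : Finset ℕ) (W H O : ℕ → Bool) (i : ℕ) : Cell :=
  ⟨w[i]?, i ∈ M, i ∈ V, W i, H i, O i⟩

/-- A tape with given marks. -/
def tape (M V : Finset ℕ) (W H O : ℕ → Bool) : List Cell :=
  (List.range (w.length + 1)).map (cell w M V W H O)

/-- One pass of the sweeping machine. -/
def sweep (s : Ctl × List Cell) : Ctl × List Cell := sweeper.pass s.1 s.2

theorem _root_.BroadcastNet.Sweeper.pass_append {Γ S A : Type} (W : Sweeper Γ S A) (v : S)
    (l l' : List A) : W.pass v (l ++ l') = ((W.pass (W.pass v l).1 l').1,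
      (W.pass v l).2 ++ (W.pass (W.pass v l).1 l').2) := by
  induction l generalizing v with
  | nil => rfl
  | cons a l ih => simp [Sweeper.pass, ih]

/-- A pass is verified cell by cell by exhibiting the control `v i` on arrival at cell `i`; the end
cell is separate because it selects the next phase. -/
theorem _root_.BroadcastNet.Sweeper.pass_range {Γ S A : Type} (W : Sweeper Γ S A) (n : ℕ)
    (c c' : ℕ → A) (v : ℕ → S) (v' : S) (h : ∀ i < n, W.trans (v i) (c i) = (v (i + 1), c' i))
    (hn : W.trans (v n) (c n) = (v', c' n)) :
    W.pass (v 0) ((List.range (n + 1)).map c) = (v', (List.range (n + 1)).map c') := by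
  have key : ∀ k ≤ n, W.pass (v 0) ((List.range k).map c) = (v k, (List.range k).map c') := by
    intro k hk
    induction k with
    | zero => rfl
    | succ k ih =>
      rw [List.range_succ, List.map_append, List.map_append, W.pass_append, ih (by omega)]
      simp [Sweeper.pass, h k (by omega)]
  rw [List.range_succ, List.map_append, List.map_append, W.pass_append, key n le_rfl]
  simp [Sweeper.pass, hn]

variable {w}

theorem cur_succ (i : ℕ) : (scan w (i + 1)).cur = extend (scan w i).cur w[i]? := by
  rw [scan]
  cases w[i]? <;> rfl

theorem pos_succ {i : ℕ} {a : Sym} (h : w[i]? = some a) : pos w (i + 1) = (pos w i).next a := by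
  rw [pos, scan_succ h]
  rfl

/-- The outer counter moves one cell to the right; for `k = 0` no cell carries it yet and the
control supplies it. The pass also resets the inner counter to `0` and the walkers to the positions
whose name agrees with the empty one there. -/
theorem sweep_derive (k : ℕ) (M V : Finset ℕ) (W H : ℕ → Bool) (cl : Bool) :
    sweep (.derive .first true true (decide (k = 0)) false false cl,
      tape w M V W H fun i => decide (i + 1 = k)) =
    (bif decide (k = w.length + 1) then .check .first true cl else .read .blank .first cl,
      tape w (derive w M) (declare w V) (fun i => decide ((scan w i).cur = []))
        (fun i => decide (i = 0)) fun i => decide (i = k)) := by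
  have key : ∀ i ≤ w.length,
      (decide (i ∈ M) || fires (pos w i) w[i]? (regs w M i).1 (regs w M i).2) =
        decide (i ∈ derive w M) ∧
      (decide (i ∈ V) || isDecl (pos w i) w[i]?) = decide (i ∈ declare w V) := by
    intro i hi
    rw [Bool.eq_iff_iff, Bool.eq_iff_iff]
    simp [mem_derive, mem_declare, hi]
  refine Eq.trans ?_ (Sweeper.pass_range sweeper w.length
    (cell w M V W H fun i => decide (i + 1 = k)) _ (fun i => .derive (pos w i)
    (decide ((scan w i).cur = [])) (decide (i = 0)) (decide (i = k)) (regs w M i).1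
    (regs w M i).2 cl) _ ?_ ?_)
  · simp only [sweep, tape, pos, scan, Parsed.start, regs, eq_comm (a := k), decide_true]
  · intro i hi
    obtain ⟨a, ha⟩ := exists_sym hi
    obtain ⟨h₁, h₂⟩ := key i hi.le
    have hc : decide ((scan w (i + 1)).cur = []) = isEnd w[i]? := by
      rw [cur_succ, isEnd_eq _ (scan w i).cur]
      exact decide_eq_decide.2 eq_comm
    simp only [sweeper, Ctl.step, cell, h₁, h₂, pos_succ ha, regs, hc]
    simp [ha]
  · obtain ⟨h₁, h₂⟩ := key _ le_rfl
    simp only [sweeper, Ctl.step, cell, h₁, h₂]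
    simp [eq_comm]

/-- What is remembered of a cell. -/
def head (w : List Sym) (M V : Finset ℕ) (h : ℕ) : Head :=
  ⟨w[h]?, pos w h, decide (h ∈ M), decide (h ∈ V)⟩

theorem sweep_read {h : ℕ} (hh : h ≤ w.length) (M V : Finset ℕ) (W O : ℕ → Bool) (cl : Bool) :
    sweep (.read .blank .first cl, tape w M V W (fun i => decide (i = h)) O) =
    (.spread (head w M V h) .first (isEnd w[h]?) false cl,
      tape w M V W (fun i => decide (i = h)) O) := by
  have key : ∀ i, (bif decide (i = h) then ⟨w[i]?, pos w i, decide (i ∈ M), decide (i ∈ V)⟩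
      else if i ≤ h then Head.blank else head w M V h) =
      if i + 1 ≤ h then Head.blank else head w M V h := by
    intro i
    rcases lt_trichotomy i h with hi | rfl | hi
    · simp [hi.ne, hi.le, Nat.succ_le_of_lt hi]
    · simp [head]
    · simp [hi.ne', hi.not_ge, show ¬ i + 1 ≤ h by omega]
  refine Eq.trans ?_ (Sweeper.pass_range sweeper w.length
    (cell w M V W (fun i => decide (i = h)) O) _
    (fun i => .read (if i ≤ h then Head.blank else head w M V h) (pos w i) cl) _ ?_ ?_)
  · simp [sweep, tape, pos, scan, Parsed.start]
  · intro i hi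
    obtain ⟨a, ha⟩ := exists_sym hi
    simp only [sweeper, Ctl.step, cell, key, pos_succ ha]
    simp [ha]
  · simp only [sweeper, Ctl.step, cell, key]
    simp [show ¬ w.length + 1 ≤ h by omega, head]

/-- Marks and clashes use the old walkers, which compare with `h`, while the new walkers, written
with a delay of one cell, compare with `h + 1`. -/
theorem sweep_spread (h : ℕ) (M V : Finset ℕ) (O : ℕ → Bool) (cl : Bool) :
    sweep (.spread (head w M V h) .first (isEnd w[h]?) false cl,
      tape w M V (fun i => decide ((scan w i).cur = (scan w h).cur)) (fun i => decide (i = h)) O) =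
    (bif decide (h = w.length) then .derive .first true true false false false
        (cl || decide (∃ x < w.length + 1, Clash w x h))
      else .read .blank .first (cl || decide (∃ x < w.length + 1, Clash w x h)),
      tape w (spread w h M) (spread w h V)
        (fun i => decide ((scan w i).cur = (scan w (h + 1)).cur))
        (fun i => decide (i = h + 1)) O) := by
  have hs : ∀ i, (decide ((scan w i).cur = (scan w h).cur) && (sort (pos w i) w[i]? != none &&
      sort (pos w i) w[i]? == sort (pos w h) w[h]?)) = decide (Same w i h) := by
    intro i
    rw [Bool.eq_iff_iff]
    simp only [Bool.and_eq_true, decide_eq_true_eq, bne_iff_ne, beq_iff_eq]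
    unfold Same
    tauto
  have key : ∀ i ≤ w.length, ∀ M, (decide (i ∈ M) || (decide (Same w i h) && decide (h ∈ M))) =
        decide (i ∈ spread w h M) := by
    intro i hi M
    rw [Bool.eq_iff_iff]
    simp [mem_spread, hi]
  have hcl : ∀ i, (cl || decide (∃ x < i, Clash w x h) || (clash (pos w i) w[i]? (pos w h) w[h]? &&
      decide ((scan w i).cur = (scan w h).cur))) = (cl || decide (∃ x < i + 1, Clash w x h)) := by
    intro i
    rw [Bool.eq_iff_iff]
    simp only [Bool.or_eq_true, decide_eq_true_eq, Bool.and_eq_true, Nat.lt_succ_iff_lt_or_eq,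
      or_and_right, exists_or, exists_eq_left, or_assoc]
    rfl
  refine Eq.trans ?_ (Sweeper.pass_range sweeper w.length
    (cell w M V (fun i => decide ((scan w i).cur = (scan w h).cur)) (fun i => decide (i = h)) O) _
    (fun i => .spread (head w M V h) (pos w i) (decide ((scan w i).cur = (scan w (h + 1)).cur))
      (decide (i = h + 1)) (cl || decide (∃ x < i, Clash w x h))) _ ?_ ?_)
  · have : isEnd w[h]? = decide ((scan w 0).cur = (scan w (h + 1)).cur) := by
      rw [cur_succ h, isEnd_eq _ (scan w h).cur]
      rfl
    simp [sweep, tape, this, pos, scan, Parsed.start]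
  · intro i hi
    obtain ⟨a, ha⟩ := exists_sym hi
    have h₁ := key i hi.le M
    have h₂ := key i hi.le V
    have h₃ : decide ((scan w (i + 1)).cur = (scan w (h + 1)).cur) =
        agree w[h]? w[i]? (decide ((scan w i).cur = (scan w h).cur)) := by
      rw [agree_eq, cur_succ, cur_succ]
    simp only [sweeper, Ctl.step, cell, head, hs, h₁, h₂, hcl, pos_succ ha, h₃]
    simp [ha]
  · have h₁ := key _ le_rfl M
    have h₂ := key _ le_rfl V
    simp only [sweeper, Ctl.step, cell, head, hs, h₁, h₂, hcl]
    simp [eq_comm]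

theorem sweep_check (M V : Finset ℕ) (W H O : ℕ → Bool) (cl : Bool) :
    (sweep (.check .first true cl, tape w M V W H O)).1 =
      .done (decide (∀ x < w.length + 1, sort (pos w x) w[x]? ≠ none → x ∈ V) && !cl &&
        pos w w.length == .qry && decide (w.length ∈ M)) := by
  have key : ∀ i, (decide (∀ x < i, sort (pos w x) w[x]? ≠ none → x ∈ V) &&
      (sort (pos w i) w[i]? == none || decide (i ∈ V))) =
      decide (∀ x < i + 1, sort (pos w x) w[x]? ≠ none → x ∈ V) := by
    intro i
    rw [Bool.eq_iff_iff]
    simp only [Bool.and_eq_true, decide_eq_true_eq, Bool.or_eq_true, beq_iff_eq,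
      Nat.forall_lt_succ_right, ne_eq, or_iff_not_imp_left]
  refine congrArg Prod.fst (a₂ := (_, tape w M V W H O))
    (Eq.trans ?_ (Sweeper.pass_range sweeper w.length
    (cell w M V W H O) _
    (fun i => .check (pos w i) (decide (∀ x < i, sort (pos w x) w[x]? ≠ none → x ∈ V)) cl)
    _ ?_ ?_))
  · simp [sweep, tape, pos, scan, Parsed.start]
  · intro i hi
    obtain ⟨a, ha⟩ := exists_sym hi
    simp only [sweeper, Ctl.step, cell, key, pos_succ ha]
    simp [ha]
  · simp only [sweeper, Ctl.step, cell, key]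
    simp

theorem iterate_inner (M V : Finset ℕ) (O : ℕ → Bool) (cl : Bool) {h : ℕ} (hh : h ≤ w.length) :
    sweep^[2 * h] (.read .blank .first cl, tape w M V (fun i => decide ((scan w i).cur = []))
      (fun i => decide (i = 0)) O) =
    (.read .blank .first (cl || decide (∃ h' < h, ∃ x < w.length + 1, Clash w x h')),
      tape w (spreads w h M) (spreads w h V) (fun i => decide ((scan w i).cur = (scan w h).cur))
        (fun i => decide (i = h)) O) := by
  induction h with
  | zero =>
    simp only [Nat.not_lt_zero, false_and, exists_false, decide_false, Bool.or_false]
    rfl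
  | succ h ih =>
    rw [show 2 * (h + 1) = 2 * h + 1 + 1 by ring, Function.iterate_succ_apply',
      Function.iterate_succ_apply', ih (by omega), sweep_read (by omega), sweep_spread]
    have : h ≠ w.length := by omega
    simp only [this, decide_false, cond_false, spreads, Bool.or_assoc, ← Bool.decide_or,
      Nat.lt_succ_iff_lt_or_eq (n := h), or_and_right, exists_or, exists_eq_left]

/-- The `2 * w.length + 3` passes are one `derive` pass, then a `read` and a `spread` pass for each
of the `w.length + 1` positions. -/
theorem iterate_round (k : ℕ) (hk : k ≤ w.length) (M V : Finset ℕ) (W H : ℕ → Bool) (cl : Bool) :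
    ∃ W' H', sweep^[2 * w.length + 3] (.derive .first true true (decide (k = 0)) false false cl,
      tape w M V W H fun i => decide (i + 1 = k)) =
    (.derive .first true true (decide (k + 1 = 0)) false false (cl || decide (Clashes w)),
      tape w (roundM w M) (roundV w V) W' H' fun i => decide (i + 1 = k + 1)) := by
  refine ⟨fun i => decide ((scan w i).cur = (scan w (w.length + 1)).cur),
    fun i => decide (i = w.length + 1), ?_⟩
  rw [show 2 * w.length + 3 = 2 * w.length + 1 + 1 + 1 by ring, Function.iterate_succ_apply,
    sweep_derive, Function.iterate_succ_apply', Function.iterate_succ_apply']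
  have : k ≠ w.length + 1 := by omega
  simp only [this, decide_false, cond_false]
  rw [iterate_inner _ _ _ _ le_rfl, sweep_read le_rfl, sweep_spread]
  simp only [decide_true, cond_true, Bool.or_assoc, ← Bool.decide_or, roundM, roundV, spreads,
    Clashes, Nat.lt_succ_iff_lt_or_eq (n := w.length), or_and_right, exists_or, exists_eq_left,
    Nat.add_right_cancel_iff]
  simp

theorem iterate_rounds {k : ℕ} (hk : k ≤ w.length + 1) : ∃ W H,
    sweep^[k * (2 * w.length + 3)] (sweeper.start, sweeper.tape w) =
    (.derive .first true true (decide (k = 0)) false false (decide (0 < k) && decide (Clashes w)),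
      tape w ((roundM w)^[k] ∅) ((roundV w)^[k] ∅) W H fun i => decide (i + 1 = k)) := by
  induction k with
  | zero =>
    refine ⟨fun _ => false, fun _ => false, ?_⟩
    have : sweeper.tape w = tape w ∅ ∅ (fun _ => false) (fun _ => false) fun _ => false := by
      simp only [tape, Sweeper.tape, sweeper, List.range_succ, List.map_append]
      congr 1
      · refine List.ext_getElem (by simp) fun i h₁ h₂ => ?_
        simp at h₁
        simp [cell, h₁]
      · simp [cell]
    rw [this]
    simp [sweeper]
  | succ k ih =>
    obtain ⟨W, H, h⟩ := ih (by omega)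
    obtain ⟨W', H', h'⟩ := iterate_round (w := w) k (by omega) ((roundM w)^[k] ∅) ((roundV w)^[k] ∅) W H
      (decide (0 < k) && decide (Clashes w))
    refine ⟨W', H', ?_⟩
    rw [show (k + 1) * (2 * w.length + 3) = 2 * w.length + 3 + k * (2 * w.length + 3) by ring,
      Function.iterate_add_apply, h, h', Function.iterate_succ_apply', Function.iterate_succ_apply']
    congr 2
    cases decide (Clashes w) <;> simp

theorem derived_iterate (hw : pos w w.length = .qry) (k : ℕ) :
    ∀ x ∈ (roundM w)^[k] ∅, Derived w x := by
  induction k with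
  | zero => simp
  | succ k ih => rw [Function.iterate_succ_apply']; exact roundM_sound hw ih

theorem declared_iterate (k : ℕ) : ∀ x ∈ (roundV w)^[k] ∅, Declared w x := by
  induction k with
  | zero => simp
  | succ k ih => rw [Function.iterate_succ_apply']; exact roundV_sound ih

theorem run_correct (w : List Sym) : ∃ b,
    (sweeper.run w ((w.length + 1) * (2 * w.length + 3) + 2)).1 = .done b ∧
      (b = true ↔ w ∈ stateCoverWaitOnly) := by
  obtain ⟨W, H, h⟩ := iterate_rounds (w := w) le_rfl
  have hM := iterate_fixed (F := roundM w) (n := w.length + 1) subset_roundM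
    (fun s => roundM_subset_range) (empty_subset _)
  have hV := iterate_fixed (F := roundV w) (n := w.length + 1) subset_roundV
    (fun s => roundV_subset_range) (empty_subset _)
  have hdM := fun hw => derived_iterate (w := w) hw (w.length + 1)
  have hdV := declared_iterate (w := w) (w.length + 1)
  generalize (roundM w)^[w.length + 1] ∅ = M at h hM hdM
  generalize (roundV w)^[w.length + 1] ∅ = V at h hV hdV
  -- One more `derive` pass precedes the check; at the fixed point it changes no marks.
  have hM' : derive w M = M :=
    ((subset_spreads _ _).trans hM.le).antisymm subset_union_left
  have hV' : declare w V = V :=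
    ((subset_spreads _ _).trans hV.le).antisymm subset_union_left
  have hrun : (sweeper.run w ((w.length + 1) * (2 * w.length + 3) + 2)).1 =
      (sweep (sweep (sweep^[(w.length + 1) * (2 * w.length + 3)]
        (sweeper.start, sweeper.tape w)))).1 := by
    rw [← Function.iterate_succ_apply' sweep, ← Function.iterate_succ_apply' sweep]
    rfl
  rw [hrun, h, sweep_derive, hM', hV']
  simp only [decide_true, cond_true]
  refine ⟨_, sweep_check _ _ _ _ _ _, ?_⟩
  rw [Parsed.mem_stateCoverWaitOnly, ← scan_length]
  simp only [Bool.and_eq_true, decide_eq_true_eq, Bool.not_eq_true', beq_iff_eq, Nat.succ_pos,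
    decide_true, Bool.true_and, decide_eq_false_iff_not]
  constructor
  · rintro ⟨⟨⟨h₁, h₂⟩, hw⟩, h₃⟩
    exact ⟨hw, (good_iff hw (hdM hw) hM hdV hV).2 ⟨h₂, h₁, h₃⟩⟩
  · rintro ⟨hw, hg⟩
    obtain ⟨h₂, h₁, h₃⟩ := (good_iff hw (hdM hw) hM hdV hV).1 hg
    exact ⟨⟨⟨h₁, h₂⟩, hw⟩, h₃⟩

end Scan

end BroadcastNet

theorem mainTheorem2 : BroadcastNet.InP BroadcastNet.stateCoverWaitOnly := by
  refine BroadcastNet.sweeper.inP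
    -- This is the exact number of passes in `run_correct`: `n + 1` rounds, a last `derive` pass and
    -- the check.
    ((Polynomial.X + 1) * (2 * Polynomial.X + 3) + 2) ?_ rfl fun w => ?_
  · rintro (_ | _ | _ | _ | b) a b' h
    iterate 4 cases h
    exact h
  · obtain ⟨b, hb, hbw⟩ := BroadcastNet.Scan.run_correct w
    refine ⟨_, ?_, b, by rw [hb]; rfl, hbw⟩
    simp
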